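/- Let $n\ge 1$, let $D=\{z\in\mathbb C^n:|z|<1\}$, and let $\underline R$ be a real constant. Let $(a^{i\bar j})_{1\le i,j\le n}$ be a measurable, Hermitian-matrix-valued function on $D$ that is uniformly elliptic: there are $0<\lambda\le\Lambda<\infty$ with $$\lambda|\xi|^2\le a^{i\bar j}(z)\,\xi_i\bar\xi_j\le\Lambda|\xi|^2\qquad\text{for a.e. } z\in D\text{ and all }\xi\in\mathbb C^n .$$ Let $(a_{k\bar l})$ be the inverse matrix, so that $\det(a_{k\bar l})=\det(a^{i\bar j})^{-1}$. For $u\in W^{1,2}(D)$ put $$I(u)=\int_D\bigl(a^{i\bar j}\,\partial_i\bar u\,\partial_{\bar j}u-2\underline R\,\mathrm{Re}\,u\bigr)\det(a_{k\bar l})\,dx ,$$ where $dx$ is Lebesgue measure and all derivatives are weak derivatives; for real-valued $u$ the integrand is $\bigl(a^{i\bar j}\partial_iu\,\partial_{\bar j}u-2\underline R u\bigr)\det(a_{k\bar l})$. Consider the Dirichlet problem $$-\partial_i\bigl(a^{i\bar j}\det(a_{k\bar l})\,\partial_{\bar j}u\bigr)=\underline R\det(a_{i\bar j})\ \text{ in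 } D,\qquad u=h\ \text{ on }\partial D, \tag{1}$$ where the boundary condition is meant in the sense of traces, and $u\in W^{1,2}(D)$ is a weak solution of the equation if $$\int_D a^{i\bar j}\det(a_{k\bar l})\,\partial_{\bar j}u\,\partial_i\varphi\,dx=\int_D\underline R\det(a_{k\bar l})\,\varphi\,dx\qquad\text{for all }\varphi\in C_c^\infty(D;\mathbb C). \tag{2}$$ (a) Let $h\in L^2(\partial D;\mathbb C)$ be the trace of some function in $W^{1,2}(D;\mathbb C)$. Then $I$ attains its minimum on the class $\{u\in W^{1,2}(D;\mathbb C): u=h\text{ on }\partial D\}$, and every minimizer is a weak solution of (1). In particular (1) has a weak solution in $W^{1,2}(D;\mathbb C)$. (b) Let $h\in L^2(\partial D;\mathbb R)$ be the trace of some function in $W^{1,2}(D)$. Then $I$ attains its minimum on the class $\{u\in W^{1,2}(D;\mathbb R): u=h\text{ on }\partial D\}$, and every minimizer $u$ in this class satisfies the real part of the equation weakly, that is, for every real-valued $\varphi\in C_c^\infty(D;\mathbb R)$ the real parts of the two sides of (2) agree. If moreover $\sum_i\partial_i\bigl(a^{i\bar j}\det(a_{k\bar l})\bigr)=0$ in $D$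 in the weak sense for every $j$, then every such $u$ is a weak solution of (1). -/

import Mathlib

open MeasureTheory Filter Topology Metric
open scoped ContDiff ComplexConjugate

noncomputable section

namespace HermitianDirichlet

/-- Complex Euclidean space `ℂⁿ` with its Hermitian norm. Its `volume` is Lebesgue measure on
`ℂⁿ = ℝ²ⁿ`. -/
abbrev Cn (n : ℕ) : Type := EuclideanSpace ℂ (Fin n)

/-- The (open) unit ball of `ℂⁿ`. -/
abbrev D (n : ℕ) : Set (Cn n) := ball 0 1

/-- Lebesgue measure on the unit ball. -/
abbrev volD (n : ℕ) : Measure (Cn n) := volume.restrict (D n)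

/-- The boundary of the unit ball. -/
abbrev bdD (n : ℕ) : Type := sphere (0 : Cn n) 1

/-- Surface measure on the unit sphere. -/
abbrev surf (n : ℕ) : Measure (bdD n) := (volume : Measure (Cn n)).toSphere

/-- `∂f / ∂zᵢ = (∂f / ∂xᵢ - √-1 ∂f / ∂yᵢ) / 2`, for (real-)differentiable `f`. -/
def del {n : ℕ} (i : Fin n) (f : Cn n → ℂ) (z : Cn n) : ℂ :=
  (fderiv ℝ f z (EuclideanSpace.single i 1)
    - Complex.I * fderiv ℝ f z (EuclideanSpace.single i Complex.I)) / 2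

/-- `∂f / ∂z̄ᵢ = (∂f / ∂xᵢ + √-1 ∂f / ∂yᵢ) / 2`, for (real-)differentiable `f`. -/
def delbar {n : ℕ} (i : Fin n) (f : Cn n → ℂ) (z : Cn n) : ℂ :=
  (fderiv ℝ f z (EuclideanSpace.single i 1)
    + Complex.I * fderiv ℝ f z (EuclideanSpace.single i Complex.I)) / 2

/-- Complex-valued test functions, `φ ∈ C_c^∞(D)`. -/
structure IsTest {n : ℕ} (φ : Cn n → ℂ) : Prop where
  smooth : ContDiff ℝ ∞ φ
  compact : HasCompactSupport φ
  supp : tsupport φ ⊆ D n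

/-- `u ∈ W^{1,2}(D)`, with weak derivatives `∂ᵢu = p i` and `∂_{ī}u = q i`. (The weak derivatives
`∂u / ∂xᵢ = p i + q i` and `∂u / ∂yᵢ = √-1 (p i - q i)` carry the same information.) -/
structure IsW12 {n : ℕ} (u : Cn n → ℂ) (p q : Fin n → Cn n → ℂ) : Prop where
  memLp : MemLp u 2 (volD n)
  memLp_del : ∀ i, MemLp (p i) 2 (volD n)
  memLp_delbar : ∀ i, MemLp (q i) 2 (volD n)
  weak_del : ∀ (i : Fin n) (φ : Cn n → ℂ), IsTest φ →
    ∫ z in D n, u z * del i φ z = - ∫ z in D n, p i z * φ z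
  weak_delbar : ∀ (i : Fin n) (φ : Cn n → ℂ), IsTest φ →
    ∫ z in D n, u z * delbar i φ z = - ∫ z in D n, q i z * φ z

/-- `u ∈ W^{1,2}(D)`, with weak derivatives `p`, `q`, has boundary values `h ∈ L²(∂D)` in the sense
of traces. The trace operator is the extension by continuity of the restriction of functions that
are smooth up to the boundary: `h` is the `L²(∂D)`-limit of the restrictions to `∂D` of smooth
functions that converge to `u` in `W^{1,2}(D)`. -/
structure HasTrace {n : ℕ} (u : Cn n → ℂ) (p q : Fin n → Cn n → ℂ) (h : bdD n → ℂ) : Prop where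
  memLp : MemLp h 2 (surf n)
  approx : ∃ f : ℕ → Cn n → ℂ, (∀ k, ContDiff ℝ ∞ (f k)) ∧
    Tendsto (fun k => eLpNorm (fun z => f k z - u z) 2 (volD n)) atTop (𝓝 0) ∧
    (∀ i, Tendsto (fun k => eLpNorm (fun z => del i (f k) z - p i z) 2 (volD n)) atTop (𝓝 0)) ∧
    (∀ i, Tendsto (fun k => eLpNorm (fun z => delbar i (f k) z - q i z) 2 (volD n)) atTop (𝓝 0)) ∧
    Tendsto (fun k => eLpNorm (fun x : bdD n => f k x - h x) 2 (surf n)) atTop (𝓝 0)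

/-- The class of admissible functions: `u ∈ W^{1,2}(D)`, with weak derivatives `∂ᵢu = p i` and
`∂_{ī}u = q i`, and `u = h` on `∂D` in the sense of traces. -/
def Admissible {n : ℕ} (h : bdD n → ℂ) (u : Cn n → ℂ) (p q : Fin n → Cn n → ℂ) : Prop :=
  IsW12 u p q ∧ HasTrace u p q h

/-- `a z i j` is the entry `a^{i j̄}` at `z`. The matrix function is measurable, Hermitian, and
uniformly elliptic on `D`: its eigenvalues lie in a fixed interval `[lam, Lam]` with `0 < lam`. -/
structure IsUniformlyElliptic {n : ℕ} (a : Cn n → Matrix (Fin n) (Fin n) ℂ) : Prop where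
  meas : ∀ i j, AEMeasurable (fun z => a z i j) (volD n)
  herm : ∀ᵐ z ∂(volD n), (a z).IsHermitian
  bounds : ∃ lam Lam : ℝ, 0 < lam ∧ ∀ᵐ z ∂(volD n), ∀ ξ : Fin n → ℂ,
    lam * ∑ i, ‖ξ i‖ ^ 2 ≤ (∑ i, ∑ j, a z i j * ξ i * conj (ξ j)).re ∧
    (∑ i, ∑ j, a z i j * ξ i * conj (ξ j)).re ≤ Lam * ∑ i, ‖ξ i‖ ^ 2

/-- `det (a_{k l̄})`, where `(a_{k l̄})` is the inverse of the matrix `(a^{i j̄})`. -/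
def detLower {n : ℕ} (a : Cn n → Matrix (Fin n) (Fin n) ℂ) (z : Cn n) : ℂ := ((a z)⁻¹).det

/-- The weak form of the left-hand side `-∂ᵢ(a^{i j̄} det(a_{k l̄}) ∂_{j̄} u)`, tested against `φ`. -/
def weakLHS {n : ℕ} (a : Cn n → Matrix (Fin n) (Fin n) ℂ) (q : Fin n → Cn n → ℂ)
    (φ : Cn n → ℂ) : ℂ :=
  ∫ z in D n, ∑ i, ∑ j, a z i j * detLower a z * q j z * del i φ z

/-- The weak form of the right-hand side `R det(a_{i j̄})`, tested against `φ`. -/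
def weakRHS {n : ℕ} (a : Cn n → Matrix (Fin n) (Fin n) ℂ) (R : ℝ) (φ : Cn n → ℂ) : ℂ :=
  ∫ z in D n, (R : ℂ) * detLower a z * φ z

/-- A function `u` with weak derivatives `∂_{j̄}u = q j` is a weak solution of
`-∂ᵢ(a^{i j̄} det(a_{k l̄}) ∂_{j̄} u) = R det(a_{i j̄})` in `D`. -/
def IsWeakSolution {n : ℕ} (a : Cn n → Matrix (Fin n) (Fin n) ℂ) (R : ℝ)
    (q : Fin n → Cn n → ℂ) : Prop :=
  ∀ φ : Cn n → ℂ, IsTest φ → weakLHS a q φ = weakRHS a R φ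

/-- Weak form of `Re (-∂ᵢ(a^{i j̄} det(a_{k l̄}) ∂_{j̄} u)) = R det(a_{i j̄})` in `D`:
real parts are taken after testing against real-valued functions. -/
def IsWeakSolutionRe {n : ℕ} (a : Cn n → Matrix (Fin n) (Fin n) ℂ) (R : ℝ)
    (q : Fin n → Cn n → ℂ) : Prop :=
  ∀ φ : Cn n → ℝ, IsTest (fun z => (φ z : ℂ)) →
    (weakLHS a q (fun z => (φ z : ℂ))).re = (weakRHS a R (fun z => (φ z : ℂ))).re

/-- The energy `∫_D (a^{i j̄} ∂ᵢū ∂_{j̄} u - 2 R Re u) det(a_{k l̄}) dx`. Here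
`∂_{j̄}u = q j`, and `∂ᵢū` is the complex conjugate of `∂_{ī}u`; for real-valued `u` it is `∂ᵢu`. -/
def energy {n : ℕ} (a : Cn n → Matrix (Fin n) (Fin n) ℂ) (R : ℝ) (u : Cn n → ℂ)
    (q : Fin n → Cn n → ℂ) : ℝ :=
  ∫ z in D n, ((∑ i, ∑ j, a z i j * conj (q i z) * q j z
    - 2 * (R : ℂ) * ((u z).re : ℂ)) * detLower a z).re

/-- `u` minimizes the energy among all complex-valued admissible functions. -/
def IsMinimizer {n : ℕ} (a : Cn n → Matrix (Fin n) (Fin n) ℂ) (R : ℝ) (h : bdD n → ℂ)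
    (u : Cn n → ℂ) (p q : Fin n → Cn n → ℂ) : Prop :=
  Admissible h u p q ∧ ∀ (v : Cn n → ℂ) (p₁ q₁ : Fin n → Cn n → ℂ),
    Admissible h v p₁ q₁ → energy a R u q ≤ energy a R v q₁

/-- The real-valued `u` minimizes the energy among all real-valued admissible functions. -/
def IsRealMinimizer {n : ℕ} (a : Cn n → Matrix (Fin n) (Fin n) ℂ) (R : ℝ) (h : bdD n → ℝ)
    (u : Cn n → ℝ) (p q : Fin n → Cn n → ℂ) : Prop :=
  Admissible (fun x => (h x : ℂ)) (fun z => (u z : ℂ)) p q ∧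
    ∀ (v : Cn n → ℝ) (p₁ q₁ : Fin n → Cn n → ℂ),
      Admissible (fun x => (h x : ℂ)) (fun z => (v z : ℂ)) p₁ q₁ →
        energy a R (fun z => (u z : ℂ)) q ≤ energy a R (fun z => (v z : ℂ)) q₁

/-- `∑ᵢ ∂ᵢ(a^{i j̄} det(a_{k l̄})) = 0` in `D` in the weak sense, for every `j`. -/
def IsDivFree {n : ℕ} (a : Cn n → Matrix (Fin n) (Fin n) ℂ) : Prop :=
  ∀ (j : Fin n) (φ : Cn n → ℂ), IsTest φ →
    ∫ z in D n, ∑ i, a z i j * detLower a z * del i φ z = 0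

end HermitianDirichlet

end

/-!
The energy is a quadratic functional `B X X - 2 ℓ X` of the triple `X = (u, ∂u, ∂̄u)`, which is
viewed in the Hilbert space `Jet n` of all triples of `L²` functions. The form `B` only sees `∂̄u`,
so that ellipticity bounds `B` from below by `‖∂̄u‖²` alone. This suffices on differences of
admissible functions: they lie in `W^{1,2}_0(D)`, the closure `zeroJets n` of the test functions
(`Admissible.sub_mem_zeroJets`), and for test functions two integrations by parts give
`‖∂φ‖ = ‖∂̄φ‖` (`IsTest.integral_norm_sq_del`), while `∂zᵢ / ∂zᵢ = 1` gives Poincaré's inequality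
(`IsTest.integral_norm_sq_le`). Hence `B` is coercive on `zeroJets n`
(`norm_sq_le_of_mem_zeroJets`), and the Lax–Milgram theorem provides a minimizer
(`exists_forall_le_of_coercive`). For real boundary values the same argument runs on the closed real
subspace of `zeroJets n` on which `u` is real.

That functions with vanishing trace are limits of test functions
(`HasTrace.exists_isTest_approx`) is shown with cutoff functions. If `g` is smooth up to the
boundary, its `L²` norm on the shell `1 - ε < |z| < 1` is bounded by `√ε` times that of its boundary
values plus `ε` times that of its gradient on the shell (`eLpNorm_shell_le`), as one sees by
integrating along rays. Cutting off costs this norm, divided by `ε`. For approximants of a function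
with vanishing trace, the first term tends to `0` for each fixed `ε`; the second one is small with
`ε`.

The Euler–Lagrange equation in the direction of `φ` is the real part of the weak equation tested
against the conjugate of `φ`. If `φ` may be multiplied by `√-1`, this is the full equation. In the
real case only real `φ` are available. If the coefficients are divergence-free, all derivatives can
be moved to the test function (`weakLHS_eq_of_isDivFree`), and the resulting expression is real for
real `u` and `φ`, because the coefficients are Hermitian (`conj_weakLHS_of_isDivFree`). Then the
imaginary parts of both sides vanish.
-/

noncomputable section

namespace HermitianDirichlet

/-! ### Wirtinger derivatives and test functions -/

/-- The first-order operator `(∂ / ∂xᵢ + s ∂ / ∂yᵢ) / 2`. It is `∂ / ∂zᵢ` for `s = -√-1` and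
`∂ / ∂z̄ᵢ` for `s = √-1`. -/
def wirtinger {n : ℕ} (s : ℂ) (i : Fin n) (f : Cn n → ℂ) (z : Cn n) : ℂ :=
  (fderiv ℝ f z (EuclideanSpace.single i 1)
    + s * fderiv ℝ f z (EuclideanSpace.single i Complex.I)) / 2

variable {n : ℕ}

lemma del_eq_wirtinger (i : Fin n) (f : Cn n → ℂ) : del i f = wirtinger (-Complex.I) i f := by
  ext z
  simp [del, wirtinger, sub_eq_add_neg]

lemma delbar_eq_wirtinger (i : Fin n) (f : Cn n → ℂ) : delbar i f = wirtinger Complex.I i f := rfl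

lemma contDiff_fderiv_apply {f : Cn n → ℂ} (hf : ContDiff ℝ ∞ f) (v : Cn n) :
    ContDiff ℝ ∞ (fun z => fderiv ℝ f z v) :=
  (hf.fderiv_right (m := ∞) le_rfl).clm_apply contDiff_const

lemma contDiff_wirtinger {f : Cn n → ℂ} (hf : ContDiff ℝ ∞ f) (s : ℂ) (i : Fin n) :
    ContDiff ℝ ∞ (wirtinger s i f) :=
  ((contDiff_fderiv_apply hf _).add (contDiff_const.mul (contDiff_fderiv_apply hf _))).div_const 2

lemma wirtinger_add {f g : Cn n → ℂ} (hf : ContDiff ℝ ∞ f) (hg : ContDiff ℝ ∞ g) (s : ℂ)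
    (i : Fin n) (z : Cn n) :
    wirtinger s i (fun z => f z + g z) z = wirtinger s i f z + wirtinger s i g z := by
  have hf' := (hf.differentiable (by simp)) z
  have hg' := (hg.differentiable (by simp)) z
  simp only [wirtinger, fderiv_fun_add hf' hg', add_apply]
  ring

lemma wirtinger_mul {f g : Cn n → ℂ} (hf : ContDiff ℝ ∞ f) (hg : ContDiff ℝ ∞ g) (s : ℂ)
    (i : Fin n) (z : Cn n) :
    wirtinger s i (fun z => f z * g z) z = wirtinger s i f z * g z + f z * wirtinger s i g z := by
  have hf' := (hf.differentiable (by simp)) z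
  have hg' := (hg.differentiable (by simp)) z
  simp only [wirtinger, fderiv_fun_mul hf' hg', add_apply,
    smul_apply, smul_eq_mul]
  ring

lemma wirtinger_const (c s : ℂ) (i : Fin n) (z : Cn n) :
    wirtinger s i (fun _ => c) z = 0 := by
  simp [wirtinger]

lemma wirtinger_const_mul {f : Cn n → ℂ} (hf : ContDiff ℝ ∞ f) (c s : ℂ)
    (i : Fin n) (z : Cn n) :
    wirtinger s i (fun z => c * f z) z = c * wirtinger s i f z := by
  rw [wirtinger_mul contDiff_const hf, wirtinger_const]
  simp

lemma contDiff_conj {f : Cn n → ℂ} (hf : ContDiff ℝ ∞ f) :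
    ContDiff ℝ ∞ (fun z => conj (f z)) :=
  Complex.conjCLE.contDiff.comp hf

lemma wirtinger_conj {f : Cn n → ℂ} (hf : ContDiff ℝ ∞ f) (s : ℂ)
    (i : Fin n) (z : Cn n) :
    wirtinger s i (fun z => conj (f z)) z = conj (wirtinger (conj s) i f z) := by
  have hf' := (hf.differentiable (by simp)) z
  have h : fderiv ℝ (fun z => conj (f z)) z =
      (Complex.conjCLE : ℂ →L[ℝ] ℂ).comp (fderiv ℝ f z) :=
    ((Complex.conjCLE : ℂ →L[ℝ] ℂ).hasFDerivAt.comp z hf'.hasFDerivAt).fderiv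
  simp [wirtinger, h, map_ofNat]

lemma del_conj {f : Cn n → ℂ} (hf : ContDiff ℝ ∞ f) (i : Fin n) (z : Cn n) :
    del i (fun z => conj (f z)) z = conj (delbar i f z) := by
  rw [del_eq_wirtinger, delbar_eq_wirtinger, wirtinger_conj hf]
  simp

lemma delbar_conj {f : Cn n → ℂ} (hf : ContDiff ℝ ∞ f) (i : Fin n) (z : Cn n) :
    delbar i (fun z => conj (f z)) z = conj (del i f z) := by
  rw [del_eq_wirtinger, delbar_eq_wirtinger, wirtinger_conj hf]
  simp

lemma fderiv_fderiv_apply {f : Cn n → ℂ} (hf : ContDiff ℝ ∞ f) (v w z : Cn n) :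
    fderiv ℝ (fun z => fderiv ℝ f z v) z w = fderiv ℝ (fderiv ℝ f) z w v := by
  have h : DifferentiableAt ℝ (fderiv ℝ f) z :=
    ((hf.fderiv_right (m := ∞) le_rfl).differentiable (by simp)) z
  rw [fderiv_clm_apply h (differentiableAt_const v)]
  simp

lemma fderiv_fderiv_comm {f : Cn n → ℂ} (hf : ContDiff ℝ ∞ f) (v w z : Cn n) :
    fderiv ℝ (fderiv ℝ f) z w v = fderiv ℝ (fderiv ℝ f) z v w :=
  (hf.contDiffAt.isSymmSndFDerivAt (by
    rw [minSmoothness_of_isRCLikeNormedField]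
    exact WithTop.coe_le_coe.2 (le_top (a := (2 : ℕ∞))))) w v

lemma wirtinger_wirtinger {f : Cn n → ℂ} (hf : ContDiff ℝ ∞ f) (s t : ℂ) (i j : Fin n)
    (z : Cn n) :
    wirtinger s i (wirtinger t j f) z =
      (fderiv ℝ (fderiv ℝ f) z (EuclideanSpace.single i 1) (EuclideanSpace.single j 1)
      + t * fderiv ℝ (fderiv ℝ f) z (EuclideanSpace.single i 1) (EuclideanSpace.single j Complex.I)
      + s * (fderiv ℝ (fderiv ℝ f) z (EuclideanSpace.single i Complex.I)
          (EuclideanSpace.single j 1)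
        + t * fderiv ℝ (fderiv ℝ f) z (EuclideanSpace.single i Complex.I)
          (EuclideanSpace.single j Complex.I))) / 4 := by
  have h1 := ((contDiff_fderiv_apply hf (EuclideanSpace.single j 1)).differentiable (by simp)) z
  have h2 := ((contDiff_fderiv_apply hf (EuclideanSpace.single j Complex.I)).differentiable
    (by simp)) z
  have key (w : Cn n) : fderiv ℝ (wirtinger t j f) z w =
      (fderiv ℝ (fderiv ℝ f) z w (EuclideanSpace.single j 1)
        + t * fderiv ℝ (fderiv ℝ f) z w (EuclideanSpace.single j Complex.I)) / 2 := by
    have : HasFDerivAt (wirtinger t j f) _ z :=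
      (h1.hasFDerivAt.add (h2.hasFDerivAt.const_mul t)).mul_const (2⁻¹ : ℂ)
    rw [this.fderiv]
    simp [fderiv_fderiv_apply hf]
    ring
  rw [wirtinger, key, key]
  ring

lemma wirtinger_comm {f : Cn n → ℂ} (hf : ContDiff ℝ ∞ f) (s t : ℂ) (i j : Fin n) :
    wirtinger s i (wirtinger t j f) = wirtinger t j (wirtinger s i f) := by
  ext z
  rw [wirtinger_wirtinger hf, wirtinger_wirtinger hf]
  simp only [fderiv_fderiv_comm hf _ (EuclideanSpace.single j _)]
  ring

lemma tsupport_wirtinger_subset (s : ℂ) (i : Fin n) (f : Cn n → ℂ) :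
    tsupport (wirtinger s i f) ⊆ tsupport f := by
  refine closure_minimal (fun z hz => ?_) (isClosed_tsupport f)
  by_contra h
  have h0 : fderiv ℝ f z = 0 := by
    have := mt (fun h' => support_fderiv_subset ℝ h') h
    simpa using this
  exact hz (by simp [wirtinger, h0])

namespace IsTest

variable {φ ψ : Cn n → ℂ}

lemma of_tsupport_subset {f : Cn n → ℂ} (hφ : IsTest φ) (hf : ContDiff ℝ ∞ f)
    (h : tsupport f ⊆ tsupport φ) : IsTest f :=
  ⟨hf, hφ.compact.of_isClosed_subset (isClosed_tsupport f) h, h.trans hφ.supp⟩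

lemma wirtinger (hφ : IsTest φ) (s : ℂ) (i : Fin n) : IsTest (wirtinger s i φ) :=
  hφ.of_tsupport_subset (contDiff_wirtinger hφ.smooth s i) (tsupport_wirtinger_subset s i φ)

lemma mul_left {f : Cn n → ℂ} (hφ : IsTest φ) (hf : ContDiff ℝ ∞ f) :
    IsTest (fun z => f z * φ z) :=
  hφ.of_tsupport_subset (hf.mul hφ.smooth) (tsupport_mul_subset_right)

lemma conjugate (hφ : IsTest φ) : IsTest (fun z => conj (φ z)) :=
  hφ.of_tsupport_subset (contDiff_conj hφ.smooth)
    (closure_mono fun z hz => by simpa using hz)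

lemma const_mul (hφ : IsTest φ) (c : ℂ) : IsTest (fun z => c * φ z) :=
  hφ.mul_left contDiff_const

lemma add (hφ : IsTest φ) (hψ : IsTest ψ) : IsTest (fun z => φ z + ψ z) where
  smooth := hφ.smooth.add hψ.smooth
  compact := hφ.compact.add hψ.compact
  supp := (tsupport_add φ ψ).trans (Set.union_subset hφ.supp hψ.supp)

lemma zero : IsTest (fun _ : Cn n => (0 : ℂ)) where
  smooth := contDiff_const
  compact := HasCompactSupport.zero
  supp := by simp [tsupport, Function.support]

lemma eq_zero (hφ : IsTest φ) {z : Cn n} (hz : z ∉ D n) : φ z = 0 :=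
  image_eq_zero_of_notMem_tsupport fun h => hz (hφ.supp h)

lemma continuous (hφ : IsTest φ) : Continuous φ := hφ.smooth.continuous

lemma integrable (hφ : IsTest φ) : Integrable φ :=
  hφ.continuous.integrable_of_hasCompactSupport hφ.compact

lemma memLp (hφ : IsTest φ) : MemLp φ 2 (volD n) :=
  (hφ.continuous.memLp_of_hasCompactSupport hφ.compact).restrict _

lemma setIntegral_eq (hφ : IsTest φ) : ∫ z in D n, φ z = ∫ z, φ z :=
  setIntegral_eq_integral_of_forall_compl_eq_zero fun _ hz => hφ.eq_zero hz

/-- Divergence theorem without boundary term. -/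
lemma integral_wirtinger (hφ : IsTest φ) (s : ℂ) (i : Fin n) :
    ∫ z in D n, HermitianDirichlet.wirtinger s i φ z = 0 := by
  rw [(hφ.wirtinger s i).setIntegral_eq]
  have hi (v : Cn n) : Integrable (fun z => fderiv ℝ φ z v) :=
    (contDiff_fderiv_apply hφ.smooth v).continuous.integrable_of_hasCompactSupport
      (hφ.compact.fderiv_apply ℝ v)
  have h0 (v : Cn n) : ∫ z, fderiv ℝ φ z v = 0 := by
    have := integral_mul_fderiv_eq_neg_fderiv_mul_of_integrable (μ := (volume : Measure (Cn n)))
      (f := fun _ => (1 : ℂ)) (g := φ) (v := v) (by simp) (by simpa using hi v)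
      (by simpa using hφ.integrable) (fun _ _ => differentiableAt_const _)
      (fun z _ => (hφ.smooth.differentiable (by simp)) z)
    simpa using this
  simp only [HermitianDirichlet.wirtinger]
  rw [integral_div, integral_add (hi _) ((hi _).const_mul s), integral_const_mul, h0, h0]
  simp

lemma integral_mul_wirtinger {f : Cn n → ℂ} (hφ : IsTest φ) (hf : ContDiff ℝ ∞ f) (s : ℂ)
    (i : Fin n) :
    ∫ z in D n, f z * HermitianDirichlet.wirtinger s i φ z =
      - ∫ z in D n, HermitianDirichlet.wirtinger s i f z * φ z := by
  have h := (hφ.mul_left hf).integral_wirtinger s i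
  simp only [wirtinger_mul hf hφ.smooth] at h
  rw [integral_add] at h
  · exact eq_neg_of_add_eq_zero_right h
  · exact (hφ.mul_left (contDiff_wirtinger hf s i)).integrable.restrict
  · exact ((hφ.wirtinger s i).mul_left hf).integrable.restrict

/-- `∂φ` and `∂̄φ` have the same `L²` norm: integrate by parts twice. -/
lemma integral_norm_sq_del (hφ : IsTest φ) (i : Fin n) :
    ∫ z in D n, ‖del i φ z‖ ^ 2 = ∫ z in D n, ‖delbar i φ z‖ ^ 2 := by
  have h1 : ∫ z in D n, conj (del i φ z) * del i φ z =
      ∫ z in D n, conj (delbar i φ z) * delbar i φ z := by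
    have e1 (z : Cn n) : conj (del i φ z) = delbar i (fun z => starRingEnd ℂ (φ z)) z :=
      (delbar_conj hφ.smooth i z).symm
    have e2 (z : Cn n) : conj (delbar i φ z) = del i (fun z => starRingEnd ℂ (φ z)) z :=
      (del_conj hφ.smooth i z).symm
    simp only [e1, e2]
    simp only [del_eq_wirtinger, delbar_eq_wirtinger]
    have hc := contDiff_conj hφ.smooth
    rw [hφ.integral_mul_wirtinger (contDiff_wirtinger hc _ i),
      hφ.integral_mul_wirtinger (contDiff_wirtinger hc _ i), wirtinger_comm hc]
  have h2 (w : ℂ) : starRingEnd ℂ w * w = ((‖w‖ ^ 2 : ℝ) : ℂ) := by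
    rw [mul_comm, Complex.mul_conj']; push_cast; rfl
  simp only [h2] at h1
  rw [integral_complex_ofReal, integral_complex_ofReal] at h1
  exact_mod_cast h1

lemma integrable_norm_sq (hφ : IsTest φ) :
    Integrable (fun z => ‖φ z‖ ^ 2) (volD n) :=
  hφ.memLp.integrable_norm_pow (by norm_num)

/-- Poincaré's inequality, from `∂zᵢ / ∂zᵢ = 1` and integration by parts. -/
lemma integral_norm_sq_le (hφ : IsTest φ) (i : Fin n) :
    ∫ z in D n, ‖φ z‖ ^ 2 ≤ 4 * ∫ z in D n, ‖delbar i φ z‖ ^ 2 := by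
  have hcoord : ContDiff ℝ ∞ (fun z : Cn n => z i) :=
    ((EuclideanSpace.proj i : Cn n →L[ℂ] ℂ).restrictScalars ℝ).contDiff
  -- The inequality is the identity `∫ |φ|² = -∫ zᵢ ∂ᵢ(φ φ̄)`, with `|zᵢ| ≤ 1` on `D`.
  have hd (z : Cn n) : HermitianDirichlet.wirtinger (-Complex.I) i (fun z : Cn n => z i) z = 1 := by
    have : HasFDerivAt (fun z : Cn n => z i)
        ((EuclideanSpace.proj i : Cn n →L[ℂ] ℂ).restrictScalars ℝ) z :=
      ((EuclideanSpace.proj i : Cn n →L[ℂ] ℂ).restrictScalars ℝ).hasFDerivAt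
    simp [HermitianDirichlet.wirtinger, this.fderiv]
  have hψ := hφ.conjugate.mul_left hφ.smooth
  have h := hψ.integral_mul_wirtinger hcoord (-Complex.I) i
  have hdel := (hφ.wirtinger (-Complex.I) i).integrable_norm_sq
  have hbar := (hφ.wirtinger Complex.I i).integrable_norm_sq
  rw [← del_eq_wirtinger] at hdel
  rw [← delbar_eq_wirtinger] at hbar
  have hsum : Integrable (fun z => ‖del i φ z‖ ^ 2 + ‖delbar i φ z‖ ^ 2) (volD n) := hdel.add hbar
  simp only [hd, one_mul, wirtinger_mul hφ.smooth hφ.conjugate.smooth,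
    wirtinger_conj hφ.smooth, map_neg, Complex.conj_I, neg_neg] at h
  simp only [Complex.mul_conj'] at h
  rw [← del_eq_wirtinger, ← delbar_eq_wirtinger] at h
  have h2 : ∫ z in D n, ((‖φ z‖ : ℂ)) ^ 2 = ((∫ z in D n, ‖φ z‖ ^ 2 : ℝ) : ℂ) := by
    rw [← integral_complex_ofReal]; simp
  rw [h2] at h
  have h3 : ∫ z in D n, ‖φ z‖ ^ 2 ≤
      ∫ z in D n, (‖φ z‖ ^ 2 / 2 + (‖del i φ z‖ ^ 2 + ‖delbar i φ z‖ ^ 2)) := by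
    have hnorm : ‖((∫ z in D n, ‖φ z‖ ^ 2 : ℝ) : ℂ)‖ = ∫ z in D n, ‖φ z‖ ^ 2 := by
      rw [Complex.norm_real, Real.norm_of_nonneg (integral_nonneg fun _ => by positivity)]
    rw [← hnorm, ← norm_neg, ← h]
    refine norm_integral_le_of_norm_le ((hφ.integrable_norm_sq.div_const 2).add hsum) ?_
    filter_upwards [ae_restrict_mem measurableSet_ball] with z hz
    have hz1 : ‖z i‖ ≤ 1 :=
      (PiLp.norm_apply_le z i).trans (by simpa using (mem_ball_zero_iff.1 hz).le)
    have h4 : ‖z i * (del i φ z * starRingEnd ℂ (φ z) + φ z * starRingEnd ℂ (delbar i φ z))‖ ≤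
        1 * (‖del i φ z‖ * ‖φ z‖ + ‖φ z‖ * ‖delbar i φ z‖) := by
      rw [norm_mul]
      gcongr
      refine (norm_add_le _ _).trans_eq (by simp)
    refine h4.trans ?_
    nlinarith [sq_nonneg (‖φ z‖ - ‖del i φ z‖ - ‖delbar i φ z‖),
      sq_nonneg (‖del i φ z‖ - ‖delbar i φ z‖)]
  rw [integral_add (hφ.integrable_norm_sq.div_const 2) hsum, integral_add hdel hbar,
    integral_div, hφ.integral_norm_sq_del i] at h3
  linarith

end IsTest

end HermitianDirichlet

namespace HermitianDirichlet

/-! ### A trace estimate on thin spherical shells -/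

/-- Integration in polar coordinates. -/
lemma lintegral_polar {E : Type*} [NormedAddCommGroup E] [NormedSpace ℝ E]
    [FiniteDimensional ℝ E] [Nontrivial E] [MeasurableSpace E] [BorelSpace E] (μ : Measure E)
    [μ.IsAddHaarMeasure] {F : E → ENNReal} (hF : Measurable F) :
    ∫⁻ x, F x ∂μ = ∫⁻ θ : sphere (0 : E) 1, (∫⁻ r in Set.Ioi (0 : ℝ),
      ENNReal.ofReal (r ^ (Module.finrank ℝ E - 1)) * F (r • (θ : E))) ∂μ.toSphere := by
  have hm : Measurable fun p : sphere (0 : E) 1 × Set.Ioi (0 : ℝ) =>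
      F ((p.2 : ℝ) • (p.1 : E)) := by
    refine hF.comp (Measurable.smul ?_ ?_) <;> fun_prop
  have h1 : ∫⁻ x, F x ∂μ = ∫⁻ x : ({(0 : E)}ᶜ : Set E), F x ∂(μ.comap (↑)) := by
    rw [lintegral_subtype_comap (measurableSet_singleton _).compl F, restrict_compl_singleton]
  have h2 := μ.measurePreserving_homeomorphUnitSphereProd.lintegral_comp_emb
    (Homeomorph.measurableEmbedding _) (fun p => F ((p.2 : ℝ) • (p.1 : E)))
  have h3 (x : ({(0 : E)}ᶜ : Set E)) :
      (((homeomorphUnitSphereProd E x).2 : ℝ) • ((homeomorphUnitSphereProd E x).1 : E)) = x := by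
    have hx : (x : E) ≠ 0 := x.2
    simp [smul_smul, hx]
  simp only [h3] at h2
  rw [h1, h2, lintegral_prod _ hm.aemeasurable]
  refine lintegral_congr fun θ => ?_
  have hmθ : Measurable fun r : Set.Ioi (0 : ℝ) => F ((r : ℝ) • (θ : E)) := by
    refine hF.comp (Measurable.smul ?_ ?_) <;> fun_prop
  rw [Measure.volumeIoiPow, lintegral_withDensity_eq_lintegral_mul _ (by fun_prop) hmθ]
  exact lintegral_subtype_comap measurableSet_Ioi
    (fun r : ℝ => ENNReal.ofReal (r ^ (Module.finrank ℝ E - 1)) * F (r • (θ : E)))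

/-- Integrate the derivative of `(r - a) r ^ k ‖γ r‖ ^ 2`, and absorb the mixed term. -/
lemma integral_pow_mul_norm_sq_le {γ γ' : ℝ → ℂ} (hγ : ∀ r, HasDerivAt γ (γ' r) r)
    (hγ' : Continuous γ') (k : ℕ) {a : ℝ} (ha : 0 ≤ a) (ha1 : a ≤ 1) :
    ∫ r in a..1, r ^ k * ‖γ r‖ ^ 2 ≤
      2 * (1 - a) * ‖γ 1‖ ^ 2 + 4 * (1 - a) ^ 2 * ∫ r in a..1, r ^ k * ‖γ' r‖ ^ 2 := by
  have hc : Continuous γ := continuous_iff_continuousAt.2 fun r => (hγ r).continuousAt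
  set G' : ℝ → ℝ := fun r => (1 * r ^ k + (r - a) * (k * r ^ (k - 1))) * ‖γ r‖ ^ 2 +
    ((r - a) * r ^ k) * (2 * inner ℝ (γ r) (γ' r)) with hG'
  have hG (r : ℝ) : HasDerivAt (fun r => ((r - a) * r ^ k) * ‖γ r‖ ^ 2) (G' r) r :=
    (((hasDerivAt_id r).sub_const a).mul (hasDerivAt_pow k r)).mul (hγ r).norm_sq
  have hGc : Continuous G' := by fun_prop
  have hFTC := intervalIntegral.integral_eq_sub_of_hasDerivAt (a := a) (b := 1)
    (fun r _ => hG r) (hGc.intervalIntegrable _ _)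
  have hc1 : Continuous fun r : ℝ => r ^ k * ‖γ r‖ ^ 2 := by fun_prop
  have hc2 : Continuous fun r : ℝ => r ^ k * ‖γ' r‖ ^ 2 := by fun_prop
  have hmono : ∫ r in a..1, (1 / 2 * (r ^ k * ‖γ r‖ ^ 2) -
      2 * (1 - a) ^ 2 * (r ^ k * ‖γ' r‖ ^ 2)) ≤ ∫ r in a..1, G' r := by
    refine intervalIntegral.integral_mono_on ha1 (Continuous.intervalIntegrable (by fun_prop) _ _)
      (hGc.intervalIntegrable _ _) fun r hr => ?_
    have hr0 : 0 ≤ r := ha.trans hr.1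
    have hra : 0 ≤ r - a := sub_nonneg.2 hr.1
    have hin : -(‖γ r‖ * ‖γ' r‖) ≤ inner ℝ (γ r) (γ' r) :=
      (abs_le.1 (abs_real_inner_le_norm _ _)).1
    have hk : 0 ≤ r ^ k := by positivity
    have h1 : 0 ≤ (r - a) * (k * r ^ (k - 1)) * ‖γ r‖ ^ 2 := by positivity
    have h2 : -((r - a) * (2 * (‖γ r‖ * ‖γ' r‖))) ≤ (r - a) * (2 * inner ℝ (γ r) (γ' r)) := by
      nlinarith
    have h3 : (r - a) * (2 * (‖γ r‖ * ‖γ' r‖)) ≤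
        1 / 2 * ‖γ r‖ ^ 2 + 2 * (1 - a) ^ 2 * ‖γ' r‖ ^ 2 := by
      have h4 : (r - a) * (2 * (‖γ r‖ * ‖γ' r‖)) ≤ (1 - a) * (2 * (‖γ r‖ * ‖γ' r‖)) :=
        mul_le_mul_of_nonneg_right (by linarith [hr.2]) (by positivity)
      nlinarith [sq_nonneg (‖γ r‖ - 2 * (1 - a) * ‖γ' r‖)]
    have h5 := mul_le_mul_of_nonneg_left (h2.trans' (neg_le_neg h3)) hk
    simp only [hG']
    linarith
  rw [intervalIntegral.integral_sub (Continuous.intervalIntegrable (by fun_prop) _ _)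
    (Continuous.intervalIntegrable (by fun_prop) _ _), intervalIntegral.integral_const_mul,
    intervalIntegral.integral_const_mul, hFTC] at hmono
  simp at hmono
  linarith

/-- The spherical shell `a < |z| < 1`. -/
def shell (n : ℕ) (a : ℝ) : Set (Cn n) := {z | a < ‖z‖ ∧ ‖z‖ < 1}

lemma measurableSet_shell (n : ℕ) (a : ℝ) : MeasurableSet (shell n a) :=
  (isOpen_lt continuous_const continuous_norm).measurableSet.inter
    (isOpen_lt continuous_norm continuous_const).measurableSet

lemma shell_subset (n : ℕ) (a : ℝ) : shell n a ⊆ D n := fun _ hz => mem_ball_zero_iff.2 hz.2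

lemma lintegral_shell {n : ℕ} (hn : 0 < n) {a : ℝ} (ha : 0 ≤ a) {F : Cn n → ENNReal}
    (hF : Measurable F) :
    ∫⁻ x in shell n a, F x = ∫⁻ θ : bdD n, (∫⁻ r in Set.Ioo a 1,
      ENNReal.ofReal (r ^ (Module.finrank ℝ (Cn n) - 1)) * F (r • (θ : Cn n))) ∂surf n := by
  have : Nonempty (Fin n) := ⟨⟨0, hn⟩⟩
  rw [← lintegral_indicator (measurableSet_shell n a),
    lintegral_polar _ (hF.indicator (measurableSet_shell n a))]
  refine lintegral_congr fun θ => ?_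
  have hθ : ‖(θ : Cn n)‖ = 1 := by simp
  rw [← lintegral_indicator measurableSet_Ioi, ← lintegral_indicator measurableSet_Ioo]
  refine lintegral_congr fun r => ?_
  by_cases hr : 0 < r
  · by_cases hs : r ∈ Set.Ioo a 1
    · have : r • (θ : Cn n) ∈ shell n a := by
        simpa [shell, norm_smul, hθ, abs_of_pos hr] using hs
      simp [hs, this, hr]
    · have : r • (θ : Cn n) ∉ shell n a := by
        simpa [shell, norm_smul, hθ, abs_of_pos hr] using hs
      simp [hs, this]
  · have hs : r ∉ Set.Ioo a 1 := fun h => hr (ha.trans_lt h.1)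
    simp [hs, hr]

/-- On a shell of width `ε = 1 - a`, the `L²` norm of `g` is at most `√(2ε)` times that of its
restriction to the sphere, plus `2ε` times that of its gradient. -/
lemma lintegral_shell_le {n : ℕ} (hn : 0 < n) {a : ℝ} (ha : 0 ≤ a) (ha1 : a ≤ 1) {g : Cn n → ℂ}
    (hg : ContDiff ℝ ∞ g) :
    ∫⁻ x in shell n a, ‖g x‖ₑ ^ 2 ≤
      ENNReal.ofReal (2 * (1 - a)) * ∫⁻ θ : bdD n, ‖g θ‖ₑ ^ 2 ∂surf n +
      ENNReal.ofReal (4 * (1 - a) ^ 2) * ∫⁻ x in shell n a, ‖fderiv ℝ g x‖ₑ ^ 2 := by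
  have hgc := hg.continuous
  have hg' : Continuous (fderiv ℝ g) := hg.continuous_fderiv (by simp)
  have hgm : Measurable fun θ : bdD n => ‖g θ‖ₑ ^ 2 :=
    (hgc.comp continuous_subtype_val).measurable.enorm.pow_const 2
  set k := Module.finrank ℝ (Cn n) - 1 with hk
  rw [lintegral_shell hn ha (by fun_prop), lintegral_shell hn ha (by fun_prop),
    ← lintegral_const_mul _ hgm,
    ← lintegral_const_mul', ← lintegral_add_left (hgm.const_mul _)]
  swap; · exact ENNReal.ofReal_ne_top
  refine lintegral_mono fun θ => ?_
  have hθ : ‖(θ : Cn n)‖ = 1 := by simp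
  have hγ (r : ℝ) : HasDerivAt (fun r : ℝ => g (r • (θ : Cn n)))
      (fderiv ℝ g (r • (θ : Cn n)) θ) r := by
    have h1 : HasDerivAt (fun r : ℝ => r • (θ : Cn n)) (θ : Cn n) r := by
      simpa using (hasDerivAt_id r).smul_const (θ : Cn n)
    exact ((hg.differentiable (by simp)) _).hasFDerivAt.comp_hasDerivAt r h1
  have hγ' : Continuous fun r : ℝ => fderiv ℝ g (r • (θ : Cn n)) θ :=
    (hg'.comp (continuous_id.smul continuous_const)).clm_apply continuous_const
  have key := integral_pow_mul_norm_sq_le hγ hγ' k ha ha1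
  have conv {f : ℝ → ℝ} (hf : Continuous f) (hf0 : ∀ r ∈ Set.Ioo a 1, 0 ≤ f r) :
      ENNReal.ofReal (∫ r in a..1, f r) = ∫⁻ r in Set.Ioo a 1, ENNReal.ofReal (f r) := by
    rw [intervalIntegral.integral_of_le ha1, integral_Ioc_eq_integral_Ioo]
    refine ofReal_integral_eq_lintegral_ofReal ?_ ?_
    · exact (hf.integrableOn_Icc (a := a) (b := 1)).mono_set Set.Ioo_subset_Icc_self
    · filter_upwards [ae_restrict_mem measurableSet_Ioo] with r hr using hf0 r hr
  have h0 : ∀ r ∈ Set.Ioo a 1, 0 ≤ r := fun r hr => ha.trans hr.1.le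
  have e {r x : ℝ} (hr : 0 ≤ r) (hx : 0 ≤ x) : ENNReal.ofReal (r ^ k * x ^ 2) =
      ENNReal.ofReal (r ^ k) * ENNReal.ofReal x ^ 2 := by
    rw [ENNReal.ofReal_mul (by positivity), ENNReal.ofReal_pow hx]
  have hε : 0 ≤ 1 - a := sub_nonneg.2 ha1
  have hI : 0 ≤ ∫ r in a..1, r ^ k * ‖fderiv ℝ g (r • (θ : Cn n)) θ‖ ^ 2 :=
    intervalIntegral.integral_nonneg ha1 fun r hr =>
      mul_nonneg (pow_nonneg (ha.trans hr.1) k) (by positivity)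
  have key2 := ENNReal.ofReal_le_ofReal key
  rw [ENNReal.ofReal_add (by positivity) (by positivity), ENNReal.ofReal_mul (by positivity),
    ENNReal.ofReal_mul (p := 4 * (1 - a) ^ 2) (by positivity),
    conv (by fun_prop) (fun r hr => mul_nonneg (pow_nonneg (h0 r hr) k) (by positivity)),
    conv (by fun_prop) (fun r hr => mul_nonneg (pow_nonneg (h0 r hr) k) (by positivity)),
    ENNReal.ofReal_pow (norm_nonneg _), one_smul, ofReal_norm] at key2
  calc _ = ∫⁻ r in Set.Ioo a 1, ENNReal.ofReal (r ^ k * ‖g (r • (θ : Cn n))‖ ^ 2) := by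
        refine setLIntegral_congr_fun measurableSet_Ioo fun r hr => ?_
        simp only [e (h0 r hr) (norm_nonneg _), ofReal_norm]
        rfl
    _ ≤ _ := key2
    _ ≤ _ := by
        gcongr _ + _ * ?_
        refine setLIntegral_mono' measurableSet_Ioo fun r hr => ?_
        rw [e (h0 r hr) (norm_nonneg _), ofReal_norm]
        gcongr
        rw [enorm_le_iff_norm_le]
        simpa [hθ] using (fderiv ℝ g (r • (θ : Cn n))).le_opNorm θ

end HermitianDirichlet

namespace HermitianDirichlet

variable {n : ℕ}

/-! ### Functions with vanishing trace are limits of test functions -/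

lemma eLpNorm_two_eq {α E : Type*} [MeasurableSpace α] [NormedAddCommGroup E] (μ : Measure α)
    (f : α → E) : eLpNorm f 2 μ = (∫⁻ x, ‖f x‖ₑ ^ 2 ∂μ) ^ (1 / 2 : ℝ) := by
  rw [eLpNorm_eq_lintegral_rpow_enorm_toReal (by norm_num) (by norm_num)]
  simp

lemma eLpNorm_indicator_shell {E : Type*} [NormedAddCommGroup E] (a : ℝ) (f : Cn n → E) :
    eLpNorm ((shell n a).indicator f) 2 (volD n) = eLpNorm f 2 (volume.restrict (shell n a)) := by
  rw [eLpNorm_indicator_eq_eLpNorm_restrict (measurableSet_shell n a),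
    Measure.restrict_restrict (measurableSet_shell n a),
    Set.inter_eq_left.2 (shell_subset n a)]

lemma eLpNorm_shell_le (hn : 0 < n) {a : ℝ} (ha : 0 ≤ a) (ha1 : a ≤ 1) {g : Cn n → ℂ}
    (hg : ContDiff ℝ ∞ g) :
    eLpNorm ((shell n a).indicator g) 2 (volD n) ≤
      ENNReal.ofReal (2 * (1 - a)) ^ (1 / 2 : ℝ) * eLpNorm (fun x : bdD n => g x) 2 (surf n) +
      ENNReal.ofReal (2 * (1 - a)) *
        eLpNorm ((shell n a).indicator (fderiv ℝ g)) 2 (volD n) := by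
  rw [eLpNorm_indicator_shell, eLpNorm_indicator_shell, eLpNorm_two_eq, eLpNorm_two_eq,
    eLpNorm_two_eq]
  refine (ENNReal.rpow_le_rpow (z := 1 / 2) (lintegral_shell_le hn ha ha1 hg)
    (by norm_num)).trans ?_
  refine (ENNReal.rpow_add_le_add_rpow _ _ (by norm_num) (by norm_num)).trans_eq ?_
  rw [ENNReal.mul_rpow_of_nonneg _ _ (by norm_num), ENNReal.mul_rpow_of_nonneg _ _ (by norm_num)]
  congr 2
  have h1 : 0 ≤ 1 - a := sub_nonneg.2 ha1
  rw [show 4 * (1 - a) ^ 2 = (2 * (1 - a)) ^ 2 by ring, ENNReal.ofReal_pow (by positivity),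
    ← ENNReal.rpow_natCast, ← ENNReal.rpow_mul]
  norm_num

lemma norm_fderiv_le (g : Cn n → ℂ) (z : Cn n) :
    ‖fderiv ℝ g z‖ ≤ ∑ i, (‖del i g z‖ + ‖delbar i g z‖) := by
  refine ContinuousLinearMap.opNorm_le_bound _ (by positivity) fun v => ?_
  have hsingle (i : Fin n) (w : ℂ) : fderiv ℝ g z (EuclideanSpace.single i w) =
      w * del i g z + starRingEnd ℂ w * delbar i g z := by
    have hw : (EuclideanSpace.single i w : Cn n) =
        w.re • EuclideanSpace.single i 1 + w.im • EuclideanSpace.single i Complex.I := by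
      ext j
      by_cases hj : j = i <;> apply Complex.ext <;> simp [hj]
    rw [hw, map_add, map_smul, map_smul, del, delbar]
    apply Complex.ext <;> simp <;> ring
  have hv : v = ∑ i, EuclideanSpace.single i (v i) := by
    ext j
    simp
  conv_lhs => rw [hv, map_sum]
  rw [Finset.sum_mul]
  refine (norm_sum_le _ _).trans (Finset.sum_le_sum fun i _ => ?_)
  rw [hsingle, add_mul]
  refine (norm_add_le _ _).trans ?_
  have hvi := PiLp.norm_apply_le v i
  simp only [norm_mul, RCLike.norm_conj]
  rw [mul_comm ‖v i‖, mul_comm ‖v i‖]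
  gcongr

lemma norm_wirtinger_le {s : ℂ} (hs : ‖s‖ = 1) (i : Fin n) (g : Cn n → ℂ) (z : Cn n) :
    ‖wirtinger s i g z‖ ≤ ‖fderiv ℝ g z‖ := by
  rw [wirtinger, norm_div, Complex.norm_ofNat, div_le_iff₀ (by norm_num)]
  refine (norm_add_le _ _).trans ?_
  rw [norm_mul, hs, one_mul, mul_two]
  gcongr <;> refine ((fderiv ℝ g z).le_opNorm _).trans_eq ?_ <;> simp

/-- Smooth cutoff functions that are `1` on `|z| ≤ 1 - 2ε`, with gradient of size `1 / ε`. -/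
lemma exists_cutoff (n : ℕ) : ∃ C : ℝ, 0 ≤ C ∧ ∀ ε : ℝ, 0 < ε → ε < 1 / 2 →
    ∃ χ : Cn n → ℝ, IsTest (fun z => (χ z : ℂ)) ∧ (∀ z, 0 ≤ χ z ∧ χ z ≤ 1) ∧
      (∀ z ∈ D n, ‖fderiv ℝ (fun z => (χ z : ℂ)) z‖ ≤ C / ε) ∧
      ∀ z ∈ D n, z ∉ shell n (1 - 2 * ε) →
        χ z = 1 ∧ fderiv ℝ (fun z => (χ z : ℂ)) z = 0 := by
  have hρ : ContDiff ℝ ∞ Real.smoothTransition := Real.smoothTransition.contDiff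
  have hcs : HasCompactSupport (deriv Real.smoothTransition) := by
    refine HasCompactSupport.intro (isCompact_Icc (a := (0 : ℝ)) (b := 1)) fun x hx => ?_
    rw [Set.mem_Icc, not_and_or, not_le, not_le] at hx
    rcases hx with hx | hx
    · have : Real.smoothTransition =ᶠ[𝓝 x] fun _ => 0 := by
        filter_upwards [Iio_mem_nhds hx] with y hy using Real.smoothTransition.zero_of_nonpos hy.le
      rw [this.deriv_eq]; simp
    · have : Real.smoothTransition =ᶠ[𝓝 x] fun _ => 1 := by
        filter_upwards [Ioi_mem_nhds hx] with y hy using Real.smoothTransition.one_of_one_le hy.le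
      rw [this.deriv_eq]; simp
  obtain ⟨C, hC⟩ := hcs.exists_bound_of_continuous (hρ.continuous_deriv (by simp))
  have hC0 : 0 ≤ C := (norm_nonneg _).trans (hC 0)
  refine ⟨C * 2, by positivity, fun ε hε hε2 => ?_⟩
  set χ : Cn n → ℝ := fun z => Real.smoothTransition ((1 - ε - ‖z‖ ^ 2) / ε) with hχ
  have hin : ContDiff ℝ ∞ fun z : Cn n => (1 - ε - ‖z‖ ^ 2) / ε :=
    (contDiff_const.sub (contDiff_norm_sq ℝ)).div_const ε
  have hχs : ContDiff ℝ ∞ χ := hρ.comp hin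
  have hχc : ContDiff ℝ ∞ fun z => (χ z : ℂ) := Complex.ofRealCLM.contDiff.comp hχs
  have hsupp : tsupport (fun z => (χ z : ℂ)) ⊆ {z : Cn n | ‖z‖ ^ 2 ≤ 1 - ε} := by
    refine closure_minimal (fun z hz => ?_) (isClosed_le (by fun_prop) continuous_const)
    by_contra h
    refine hz ?_
    simp only [Set.mem_ofPred_eq, not_le] at h
    have : χ z = 0 := Real.smoothTransition.zero_of_nonpos
      (div_nonpos_of_nonpos_of_nonneg (by linarith) hε.le)
    simp [this]
  have hsupp2 : {z : Cn n | ‖z‖ ^ 2 ≤ 1 - ε} ⊆ D n := fun z hz => by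
    have h1 : ‖z‖ ^ 2 ≤ 1 - ε := hz
    rw [mem_ball_zero_iff]
    nlinarith [norm_nonneg z]
  refine ⟨χ, ⟨hχc, ?_, hsupp.trans hsupp2⟩, fun z => ⟨Real.smoothTransition.nonneg _,
    Real.smoothTransition.le_one _⟩, fun z hz => ?_, fun z hz hz2 => ?_⟩
  · exact (isCompact_closedBall (0 : Cn n) 1).of_isClosed_subset (isClosed_tsupport _)
      ((hsupp.trans hsupp2).trans ball_subset_closedBall)
  · have h1 : HasFDerivAt (fun z : Cn n => (1 - ε - ‖z‖ ^ 2) / ε)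
        (ε⁻¹ • (-((2 : ℕ) • innerSL ℝ z : Cn n →L[ℝ] ℝ) : Cn n →L[ℝ] ℝ)) z := by
      have h := ((hasStrictFDerivAt_norm_sq z).hasFDerivAt.const_sub (1 - ε)).mul_const ε⁻¹
      simpa [div_eq_mul_inv] using h
    have h2 := ((hρ.differentiable (by simp)) ((1 - ε - ‖z‖ ^ 2) / ε)).hasDerivAt.comp_hasFDerivAt
      z h1
    have h3 : HasFDerivAt (fun z => (χ z : ℂ)) _ z := Complex.ofRealCLM.hasFDerivAt.comp z h2
    rw [h3.fderiv]
    refine ContinuousLinearMap.opNorm_le_bound _ (by positivity) fun v => ?_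
    have hz1 : ‖z‖ ≤ 1 := (mem_ball_zero_iff.1 hz).le
    have hi : ‖inner ℝ z v‖ ≤ 1 * ‖v‖ := (norm_inner_le_norm z v).trans (by gcongr)
    have hCz := hC ((1 - ε - ‖z‖ ^ 2) / ε)
    simp only [ContinuousLinearMap.comp_apply, Complex.ofRealCLM_apply, Complex.norm_real]
    simp only [smul_apply, neg_apply, innerSL_apply_apply, norm_neg, nsmul_eq_mul,
      norm_mul, norm_inv, Real.norm_of_nonneg hε.le, smul_eq_mul]
    calc _ ≤ C * (ε⁻¹ * (2 * (1 * ‖v‖))) := by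
          gcongr
          norm_num
      _ = _ := by ring
  · have hz1 : ‖z‖ ≤ 1 - 2 * ε := by
      by_contra h
      exact hz2 ⟨not_le.1 h, mem_ball_zero_iff.1 hz⟩
    have hz3 : ‖z‖ ^ 2 < 1 - 2 * ε := by nlinarith [norm_nonneg z]
    have hev : (fun z => (χ z : ℂ)) =ᶠ[𝓝 z] fun _ => 1 := by
      filter_upwards [(isOpen_lt (by fun_prop : Continuous fun z : Cn n => ‖z‖ ^ 2)
        continuous_const).mem_nhds hz3] with y hy
      have h1 : ‖y‖ ^ 2 < 1 - 2 * ε := hy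
      have : χ y = 1 := Real.smoothTransition.one_of_one_le (by
        rw [le_div_iff₀ hε]; linarith)
      simp [this]
    refine ⟨by exact_mod_cast hev.eq_of_nhds, ?_⟩
    rw [hev.fderiv_eq]
    simp

lemma tendsto_volD_shell (n : ℕ) :
    Tendsto (fun m : ℕ => volD n (shell n (1 - 2 * (1 / (m + 3) : ℝ)))) atTop (𝓝 0) := by
  have h := tendsto_measure_iInter_atTop (μ := volD n)
    (s := fun m : ℕ => shell n (1 - 2 * (1 / (m + 3) : ℝ)))
    (fun m => (measurableSet_shell n _).nullMeasurableSet)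
    (fun m k hmk z hz => ⟨lt_of_le_of_lt (by gcongr) hz.1, hz.2⟩)
    ⟨0, ((measure_mono (Set.subset_univ _)).trans_lt (by
      simpa using (measure_ball_lt_top (μ := (volume : Measure (Cn n)))))).ne⟩
  have he : ⋂ m : ℕ, shell n (1 - 2 * (1 / (m + 3) : ℝ)) = ∅ := by
    refine Set.eq_empty_of_forall_notMem fun z hz => ?_
    rw [Set.mem_iInter] at hz
    have hz1 : 0 < 1 - ‖z‖ := sub_pos.2 (hz 0).2
    obtain ⟨m, hm⟩ := exists_nat_gt (2 / (1 - ‖z‖))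
    have h1 := (hz m).1
    rw [div_lt_iff₀ hz1] at hm
    have h2 : 2 * (1 / ((m : ℝ) + 3)) < 1 - ‖z‖ := by
      rw [mul_one_div, div_lt_iff₀ (by positivity)]
      nlinarith
    linarith
  rw [he, measure_empty] at h
  exact h

lemma eventually_eLpNorm_indicator_shell_le {f : Cn n → ℂ} (hf : MemLp f 2 (volD n)) {δ : ℝ}
    (hδ : 0 < δ) :
    ∀ᶠ m : ℕ in atTop, eLpNorm ((shell n (1 - 2 * (1 / (m + 3) : ℝ))).indicator f) 2 (volD n) ≤
      ENNReal.ofReal δ := by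
  obtain ⟨d, hd, h⟩ := hf.eLpNorm_indicator_le (by norm_num) (by norm_num) hδ
  filter_upwards [(tendsto_volD_shell n).eventually (ge_mem_nhds (ENNReal.ofReal_pos.2 hd))] with m hm
  exact h _ (measurableSet_shell n _) hm

end HermitianDirichlet

namespace HermitianDirichlet

variable {n : ℕ}

lemma eLpNorm_cutoff_mul_sub_le {a : ℝ} {χ : Cn n → ℝ} (hχ : Continuous χ)
    (hχ01 : ∀ z, 0 ≤ χ z ∧ χ z ≤ 1) (hχ1 : ∀ z ∈ D n, z ∉ shell n a → χ z = 1)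
    {f g : Cn n → ℂ} (hf : Continuous f) (hg : AEStronglyMeasurable g (volD n)) :
    eLpNorm (fun z => χ z * f z - g z) 2 (volD n) ≤
      eLpNorm (fun z => f z - g z) 2 (volD n) + eLpNorm ((shell n a).indicator g) 2 (volD n) := by
  have hχm : AEStronglyMeasurable (fun z => (χ z : ℂ)) (volD n) := by
    exact (Complex.continuous_ofReal.comp hχ).aestronglyMeasurable
  have hfm : AEStronglyMeasurable f (volD n) := hf.aestronglyMeasurable
  have hsplit : (fun z => χ z * f z - g z) =
      (fun z => χ z * (f z - g z)) + fun z => (χ z - 1) * g z := by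
    ext z; simp; ring
  rw [hsplit]
  refine (eLpNorm_add_le (hχm.mul (hfm.sub hg)) ((hχm.sub aestronglyMeasurable_const).mul hg)
    (by norm_num)).trans (add_le_add ?_ ?_)
  · refine eLpNorm_mono fun z => ?_
    simp only [Pi.mul_apply, Pi.sub_apply]
    rw [norm_mul, Complex.norm_real, Real.norm_of_nonneg (hχ01 z).1]
    exact mul_le_of_le_one_left (norm_nonneg _) (hχ01 z).2
  · refine eLpNorm_mono_ae ?_
    filter_upwards [ae_restrict_mem measurableSet_ball] with z hz
    by_cases hS : z ∈ shell n a
    · simp only [Pi.mul_apply, Pi.sub_apply]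
      rw [Set.indicator_of_mem hS, norm_mul, ← Complex.ofReal_one, ← Complex.ofReal_sub,
        Complex.norm_real]
      refine mul_le_of_le_one_left (norm_nonneg _) ?_
      rw [Real.norm_eq_abs, abs_le]
      constructor <;> linarith [(hχ01 z).1, (hχ01 z).2]
    · simp [hχ1 z hz hS]

/-- By the estimate on thin shells, multiplying smooth approximants of a function with vanishing
trace by cutoff functions costs little in `W^{1,2}`. -/
lemma HasTrace.exists_isTest_approx (hn : 0 < n) {u : Cn n → ℂ} {p q : Fin n → Cn n → ℂ}
    (hu : MemLp u 2 (volD n)) (hp : ∀ i, MemLp (p i) 2 (volD n))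
    (hq : ∀ i, MemLp (q i) 2 (volD n)) (hT : HasTrace u p q fun _ => 0) {η : ℝ} (hη : 0 < η) :
    ∃ φ, IsTest φ ∧ eLpNorm (fun z => φ z - u z) 2 (volD n) ≤ ENNReal.ofReal η ∧
      (∀ i, eLpNorm (fun z => del i φ z - p i z) 2 (volD n) ≤ ENNReal.ofReal η) ∧
      ∀ i, eLpNorm (fun z => delbar i φ z - q i z) 2 (volD n) ≤ ENNReal.ofReal η := by
  obtain ⟨C, hC0, hC⟩ := exists_cutoff n
  obtain ⟨f, hf, hfu, hfp, hfq, hfh⟩ := hT.approx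
  -- The final error consists of three terms of size `δ` and of the gradient of the approximant on
  -- the shell, of size `2n · 2δ`, times `4ε · C / ε = 4C`.
  set δ : ℝ := η / (3 + 4 * C * (n * 2) * 2) with hδ
  have hδ0 : 0 < δ := by positivity
  have hδη : 3 * δ + 4 * C * (n * 2) * 2 * δ = η := by rw [hδ]; field_simp
  -- The width of the shell depends on `u`, `p`, `q` only; the approximant is chosen afterwards.
  obtain ⟨m, hmu, hmp, hmq⟩ := ((eventually_eLpNorm_indicator_shell_le hu hδ0).and
    ((eventually_all.2 fun i => eventually_eLpNorm_indicator_shell_le (hp i) hδ0).and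
    (eventually_all.2 fun i => eventually_eLpNorm_indicator_shell_le (hq i) hδ0))).exists
  set ε : ℝ := 1 / (m + 3) with hε
  have hε0 : 0 < ε := by positivity
  have hε2 : ε < 1 / 2 := by
    rw [hε, div_lt_div_iff₀ (by positivity) (by norm_num)]
    linarith [(Nat.cast_nonneg m : (0 : ℝ) ≤ m)]
  obtain ⟨χ, hχ, hχ01, hχd, hχ1⟩ := hC ε hε0 hε2
  set S := shell n (1 - 2 * ε) with hS
  have hfin : ENNReal.ofReal (C / ε) * ENNReal.ofReal (2 * (1 - (1 - 2 * ε))) ^ (1 / 2 : ℝ) ≠ ⊤ :=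
    ENNReal.mul_ne_top ENNReal.ofReal_ne_top
      (ENNReal.rpow_ne_top_of_nonneg (by norm_num) ENNReal.ofReal_ne_top)
  have hfh' := ENNReal.Tendsto.const_mul hfh (Or.inr hfin)
  rw [mul_zero] at hfh'
  have hδ' : 0 < ENNReal.ofReal δ := ENNReal.ofReal_pos.2 hδ0
  obtain ⟨k, hku, hkp, hkq, hkh⟩ := ((hfu.eventually (ge_mem_nhds hδ')).and
    ((eventually_all.2 fun i => (hfp i).eventually (ge_mem_nhds hδ')).and
    ((eventually_all.2 fun i => (hfq i).eventually (ge_mem_nhds hδ')).and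
    (hfh'.eventually (ge_mem_nhds hδ'))))).exists
  set g := f k
  have hg : ContDiff ℝ ∞ g := hf k
  have hχc : Continuous χ := by
    exact Complex.isometry_ofReal.isEmbedding.continuous_iff.2 hχ.continuous
  have hSm : MeasurableSet S := measurableSet_shell n _
  -- One partial derivative of the approximant on the shell.
  have hderiv {s : ℂ} {i : Fin n} {v : Cn n → ℂ} (hv : MemLp v 2 (volD n))
      (h1 : eLpNorm (fun z => wirtinger s i g z - v z) 2 (volD n) ≤ ENNReal.ofReal δ)
      (h2 : eLpNorm (S.indicator v) 2 (volD n) ≤ ENNReal.ofReal δ) :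
      eLpNorm (S.indicator (wirtinger s i g)) 2 (volD n) ≤ ENNReal.ofReal (2 * δ) := by
    have hw : AEStronglyMeasurable (wirtinger s i g) (volD n) :=
      (contDiff_wirtinger hg s i).continuous.aestronglyMeasurable
    have hsplit : S.indicator (wirtinger s i g) =
        S.indicator (fun z => wirtinger s i g z - v z) + S.indicator v := by
      rw [← Set.indicator_add']
      congr 1; ext z; simp
    rw [hsplit, two_mul, ENNReal.ofReal_add hδ0.le hδ0.le]
    exact (eLpNorm_add_le ((hw.sub hv.1).indicator hSm) (hv.1.indicator hSm) (by norm_num)).trans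
      (add_le_add ((eLpNorm_indicator_le _).trans h1) h2)
  have hgrad : eLpNorm (S.indicator (fderiv ℝ g)) 2 (volD n) ≤
      ENNReal.ofReal ((n * 2) * (2 * δ)) := by
    have hm (s : ℂ) (i : Fin n) : AEStronglyMeasurable
        (fun z => ‖S.indicator (wirtinger s i g) z‖) (volD n) :=
      ((contDiff_wirtinger hg s i).continuous.aestronglyMeasurable.indicator hSm).norm
    calc eLpNorm (S.indicator (fderiv ℝ g)) 2 (volD n)
        ≤ eLpNorm (∑ i, ((fun z => ‖S.indicator (del i g) z‖) +
            fun z => ‖S.indicator (delbar i g) z‖)) 2 (volD n) := by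
          refine eLpNorm_mono_real fun z => ?_
          by_cases hz : z ∈ S
          · simpa [hz] using norm_fderiv_le g z
          · simp [hz]
      _ ≤ ∑ i : Fin n, ENNReal.ofReal (2 * (2 * δ)) := by
          refine (eLpNorm_sum_le (fun i _ => (?_ : AEStronglyMeasurable _ _))
            (by norm_num)).trans (Finset.sum_le_sum fun i _ => ?_)
          · rw [del_eq_wirtinger, delbar_eq_wirtinger]
            exact (hm _ i).add (hm _ i)
          · rw [del_eq_wirtinger, delbar_eq_wirtinger]
            refine (eLpNorm_add_le (hm _ i) (hm _ i) (by norm_num)).trans ?_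
            rw [eLpNorm_norm, eLpNorm_norm, two_mul (2 * δ),
              ENNReal.ofReal_add (by positivity) (by positivity)]
            refine add_le_add (hderiv (hp i) ?_ (hmp i)) (hderiv (hq i) (hkq i) (hmq i))
            rw [← del_eq_wirtinger]
            exact hkp i
      _ = ENNReal.ofReal ((n * 2) * (2 * δ)) := by
          rw [Finset.sum_const, Finset.card_univ, Fintype.card_fin, ← ENNReal.ofReal_nsmul]
          congr 1
          simp; ring
  have hε1 : 0 ≤ 1 - 2 * ε := by linarith
  have hmain : ENNReal.ofReal (C / ε) * eLpNorm (S.indicator g) 2 (volD n) ≤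
      ENNReal.ofReal (δ + 4 * C * (n * 2) * 2 * δ) := by
    refine (mul_le_mul_right (eLpNorm_shell_le hn hε1 (by linarith) hg) _).trans ?_
    rw [mul_add, ← mul_assoc, ENNReal.ofReal_add hδ0.le (by positivity)]
    refine add_le_add (by simpa using hkh) ?_
    refine (mul_le_mul_right (mul_le_mul_right hgrad _) _).trans_eq ?_
    rw [← ENNReal.ofReal_mul (by linarith), ← ENNReal.ofReal_mul (by positivity)]
    congr 1
    field_simp
    ring
  have hχ1' : ∀ z ∈ D n, z ∉ S → χ z = 1 := fun z hz hzS => (hχ1 z hz hzS).1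
  have hfinal {s : ℂ} (hs : ‖s‖ = 1) {i : Fin n} {v : Cn n → ℂ} (hv : MemLp v 2 (volD n))
      (h1 : eLpNorm (fun z => wirtinger s i g z - v z) 2 (volD n) ≤ ENNReal.ofReal δ)
      (h2 : eLpNorm (S.indicator v) 2 (volD n) ≤ ENNReal.ofReal δ) :
      eLpNorm (fun z => wirtinger s i (fun z => χ z * g z) z - v z) 2 (volD n) ≤
        ENNReal.ofReal η := by
    have hw : Continuous (wirtinger s i g) := (contDiff_wirtinger hg s i).continuous
    have hwχ : Continuous (wirtinger s i fun z => (χ z : ℂ)) :=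
      (contDiff_wirtinger hχ.smooth s i).continuous
    have hsplit : (fun z => wirtinger s i (fun z => χ z * g z) z - v z) =
        (fun z => χ z * wirtinger s i g z - v z) +
          fun z => wirtinger s i (fun z => (χ z : ℂ)) z * g z := by
      ext z
      simp only [wirtinger_mul hχ.smooth hg, Pi.add_apply]
      ring
    rw [hsplit, ← hδη]
    refine (eLpNorm_add_le (((Complex.continuous_ofReal.comp hχc).mul hw).aestronglyMeasurable.sub
      hv.1) (hwχ.mul hg.continuous).aestronglyMeasurable (by norm_num)).trans ?_
    have e : 3 * δ + 4 * C * (n * 2) * 2 * δ = δ + δ + (δ + 4 * C * (n * 2) * 2 * δ) := by ring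
    rw [e, ENNReal.ofReal_add (by positivity) (by positivity),
      ENNReal.ofReal_add hδ0.le hδ0.le]
    refine add_le_add ((eLpNorm_cutoff_mul_sub_le hχc hχ01 hχ1' hw hv.1).trans
      (add_le_add h1 h2)) (le_trans ?_ hmain)
    refine eLpNorm_le_mul_eLpNorm_of_ae_le_mul ?_ 2
    filter_upwards [ae_restrict_mem measurableSet_ball] with z hz
    have hwz := norm_wirtinger_le hs i (fun z => (χ z : ℂ)) z
    rw [Pi.mul_apply, norm_mul]
    by_cases hzS : z ∈ S
    · rw [Set.indicator_of_mem hzS]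
      gcongr
      exact hwz.trans (hχd z hz)
    · rw [(hχ1 z hz hzS).2, norm_zero] at hwz
      simp [norm_le_zero_iff.1 hwz, hzS]
  have hφ : IsTest fun z => (χ z : ℂ) * g z := by
    simpa only [mul_comm] using hχ.mul_left hg
  refine ⟨_, hφ, ?_, fun i => ?_, fun i => ?_⟩
  · refine (eLpNorm_cutoff_mul_sub_le hχc hχ01 hχ1' hg.continuous hu.1).trans
      ((add_le_add hku hmu).trans ?_)
    rw [← ENNReal.ofReal_add hδ0.le hδ0.le]
    refine ENNReal.ofReal_le_ofReal ?_
    have : 0 ≤ 4 * C * (n * 2) * 2 * δ := by positivity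
    linarith
  · rw [del_eq_wirtinger]
    refine hfinal (by simp) (hp i) ?_ (hmp i)
    rw [← del_eq_wirtinger]
    exact hkp i
  · exact hfinal (by simp) (hq i) (hkq i) (hmq i)

end HermitianDirichlet

namespace HermitianDirichlet

variable {n : ℕ}

/-! ### The coefficients -/

section Matrix

variable {A : Matrix (Fin n) (Fin n) ℂ} {lam Lam : ℝ}

lemma eigenvalues_mem_Icc (hA : A.IsHermitian)
    (h : ∀ ξ : Fin n → ℂ, lam * ∑ i, ‖ξ i‖ ^ 2 ≤ (∑ i, ∑ j, A i j * ξ i * conj (ξ j)).re ∧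
      (∑ i, ∑ j, A i j * ξ i * conj (ξ j)).re ≤ Lam * ∑ i, ‖ξ i‖ ^ 2) (k : Fin n) :
    hA.eigenvalues k ∈ Set.Icc lam Lam := by
  have h1 := h (fun i => conj (hA.eigenvectorBasis k i))
  have h2 : ∑ i, ‖conj (hA.eigenvectorBasis k i)‖ ^ 2 = 1 := by
    have := hA.eigenvectorBasis.norm_eq_one k
    rw [EuclideanSpace.norm_eq, Real.sqrt_eq_one] at this
    simpa using this
  have h3 : ∑ i, ∑ j, A i j * conj (hA.eigenvectorBasis k i) *
      conj (conj (hA.eigenvectorBasis k j)) =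
      dotProduct (star (hA.eigenvectorBasis k).ofLp)
        (A.mulVec (hA.eigenvectorBasis k).ofLp) := by
    simp only [dotProduct, Matrix.mulVec, Finset.mul_sum]
    refine Finset.sum_congr rfl fun i _ => Finset.sum_congr rfl fun j _ => ?_
    simp
    ring
  rw [h2, h3] at h1
  rw [hA.eigenvalues_eq]
  simpa using h1

lemma exists_det_inv_eq (hn : 0 < n) (hA : A.IsHermitian) (hlam : 0 < lam)
    (h : ∀ ξ : Fin n → ℂ, lam * ∑ i, ‖ξ i‖ ^ 2 ≤ (∑ i, ∑ j, A i j * ξ i * conj (ξ j)).re ∧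
      (∑ i, ∑ j, A i j * ξ i * conj (ξ j)).re ≤ Lam * ∑ i, ‖ξ i‖ ^ 2) :
    ∃ d : ℝ, A⁻¹.det = d ∧ (Lam ^ n)⁻¹ ≤ d ∧ d ≤ (lam ^ n)⁻¹ ∧ lam ≤ Lam := by
  have he := eigenvalues_mem_Icc hA h
  have h0 (k : Fin n) : 0 ≤ hA.eigenvalues k := hlam.le.trans (he k).1
  have hup : ∏ k, hA.eigenvalues k ≤ Lam ^ n := by
    simpa using Finset.prod_le_prod (s := Finset.univ) (fun k _ => h0 k) fun k _ => (he k).2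
  have hlow : lam ^ n ≤ ∏ k, hA.eigenvalues k := by
    simpa using Finset.prod_le_prod (s := Finset.univ) (fun k _ => hlam.le) fun k _ => (he k).1
  have hpos : 0 < ∏ k, hA.eigenvalues k := (pow_pos hlam n).trans_le hlow
  refine ⟨(∏ k, hA.eigenvalues k)⁻¹, ?_, inv_anti₀ hpos hup, inv_anti₀ (pow_pos hlam n) hlow,
    (he ⟨0, hn⟩).1.trans (he ⟨0, hn⟩).2⟩
  rw [Matrix.det_nonsing_inv, Ring.inverse_eq_inv', hA.det_eq_prod_eigenvalues]
  push_cast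
  rfl

/-- Test the quadratic form with `eᵢ + s eⱼ`, where `|s| = 1`. -/
lemma norm_entry_le (hA : A.IsHermitian) (hlam : 0 < lam)
    (h : ∀ ξ : Fin n → ℂ, lam * ∑ i, ‖ξ i‖ ^ 2 ≤ (∑ i, ∑ j, A i j * ξ i * conj (ξ j)).re ∧
      (∑ i, ∑ j, A i j * ξ i * conj (ξ j)).re ≤ Lam * ∑ i, ‖ξ i‖ ^ 2) (i j : Fin n) :
    ‖A i j‖ ≤ 2 * Lam := by
  have hdiag (k : Fin n) : 0 ≤ (A k k).re ∧ (A k k).re ≤ Lam := by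
    have := h (Pi.single k 1)
    simp [Pi.single_apply, apply_ite] at this
    exact ⟨hlam.le.trans this.1, this.2⟩
  have hLam := (hdiag i).1.trans (hdiag i).2
  by_cases h0 : A i j = 0
  · simp [h0, hLam]
  set s : ℂ := A i j / ‖A i j‖ with hs
  have hne : (‖A i j‖ : ℂ) ≠ 0 := by simpa using h0
  have hs1 : ‖s‖ = 1 := by simp [hs, h0]
  -- With this `s`, the mixed terms of the quadratic form add up to `2 |aᵢⱼ|`.
  have hval : A i j * conj s = ‖A i j‖ := by
    rw [hs, map_div₀, ← mul_div_assoc, Complex.mul_conj', Complex.conj_ofReal]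
    field_simp
  have hval2 : A j i * s = ‖A i j‖ := by
    have := congrArg conj hval
    have e : conj (A i j) = A j i := hA.apply j i
    rwa [map_mul, Complex.conj_conj, Complex.conj_ofReal, e] at this
  have hξ := (h (fun k => (Pi.single i 1 : Fin n → ℂ) k + (Pi.single j s : Fin n → ℂ) k)).2
  have hsum : ∑ k, ∑ l, A k l * ((Pi.single i 1 : Fin n → ℂ) k + (Pi.single j s : Fin n → ℂ) k) *
      conj ((Pi.single i 1 : Fin n → ℂ) l + (Pi.single j s : Fin n → ℂ) l) =
      A i i + A i j * conj s + (A j i * s + A j j * (s * conj s)) := by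
    have hc (k l : Fin n) (t : ℂ) : conj ((Pi.single k t : Fin n → ℂ) l) =
        if l = k then conj t else 0 := by
      by_cases hkl : l = k <;> simp [hkl]
    simp only [map_add, hc, map_one]
    simp only [mul_add, add_mul, Finset.sum_add_distrib, Pi.single_apply,
      mul_ite, ite_mul, mul_zero, zero_mul, mul_one, Finset.sum_ite_eq', Finset.mem_univ, if_true]
    ring
  have hnorm : ∑ k, ‖(Pi.single i 1 : Fin n → ℂ) k + (Pi.single j s : Fin n → ℂ) k‖ ^ 2 ≤ 4 := by
    calc _ ≤ ∑ k, (2 * ‖(Pi.single i 1 : Fin n → ℂ) k‖ ^ 2 +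
          2 * ‖(Pi.single j s : Fin n → ℂ) k‖ ^ 2) := by
          refine Finset.sum_le_sum fun k _ => ?_
          have := norm_add_le ((Pi.single i 1 : Fin n → ℂ) k) ((Pi.single j s : Fin n → ℂ) k)
          nlinarith [norm_nonneg ((Pi.single i 1 : Fin n → ℂ) k + (Pi.single j s : Fin n → ℂ) k),
            sq_nonneg (‖(Pi.single i 1 : Fin n → ℂ) k‖ - ‖(Pi.single j s : Fin n → ℂ) k‖)]
      _ = 4 := by
          have hc (k l : Fin n) (t : ℂ) : ‖(Pi.single k t : Fin n → ℂ) l‖ ^ 2 =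
              if l = k then ‖t‖ ^ 2 else 0 := by
            by_cases hkl : l = k <;> simp [hkl]
          simp only [hc, hs1, norm_one, Finset.sum_add_distrib, mul_ite, mul_zero,
            Finset.sum_ite_eq', Finset.mem_univ, if_true]
          norm_num
  rw [hsum, hval, hval2, Complex.mul_conj', hs1] at hξ
  simp at hξ
  have := mul_le_mul_of_nonneg_left hnorm hLam
  linarith [(hdiag i).1, (hdiag j).1]

end Matrix

lemma IsUniformlyElliptic.aemeasurable_detLower {a : Cn n → Matrix (Fin n) (Fin n) ℂ}
    (ha : IsUniformlyElliptic a) : AEMeasurable (detLower a) (volD n) := by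
  have : detLower a = fun z => (∑ σ : Equiv.Perm (Fin n),
      ((Equiv.Perm.sign σ : ℤ) : ℂ) * ∏ i, a z (σ i) i)⁻¹ := by
    ext z
    rw [detLower, Matrix.det_nonsing_inv, Ring.inverse_eq_inv', Matrix.det_apply']
  rw [this]
  refine AEMeasurable.inv (Finset.aemeasurable_fun_sum _ fun σ _ => ?_)
  exact (Finset.aemeasurable_fun_prod _ fun i _ => ha.meas _ _).const_mul _

/-- The weighted coefficients `a^{i j̄} det(a_{k l̄})`. -/
def coeff (a : Cn n → Matrix (Fin n) (Fin n) ℂ) (i j : Fin n) (z : Cn n) : ℂ :=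
  a z i j * detLower a z

/-- The weighted coefficients are bounded, Hermitian and elliptic, and `det(a_{k l̄})` is real and
bounded. -/
lemma IsUniformlyElliptic.exists_bounds (hn : 0 < n) {a : Cn n → Matrix (Fin n) (Fin n) ℂ}
    (ha : IsUniformlyElliptic a) : ∃ c M : ℝ, 0 < c ∧ ∀ᵐ z ∂(volD n),
      ‖detLower a z‖ ≤ M ∧ conj (detLower a z) = detLower a z ∧
      (∀ i j, ‖coeff a i j z‖ ≤ M) ∧ (∀ i j, conj (coeff a i j z) = coeff a j i z) ∧
      ∀ ξ : Fin n → ℂ, c * ∑ i, ‖ξ i‖ ^ 2 ≤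
        (∑ i, ∑ j, coeff a i j z * conj (ξ i) * ξ j).re := by
  obtain ⟨lam, Lam, hlam, hb⟩ := ha.bounds
  by_cases hLam : lam ≤ Lam
  swap
  · -- Otherwise no point satisfies the bounds.
    refine ⟨1, 0, one_pos, ?_⟩
    filter_upwards [ha.herm, hb] with z hz hbz
    obtain ⟨d, -, -, -, hd⟩ := exists_det_inv_eq hn hz hlam hbz
    exact absurd hd hLam
  have hLam0 : 0 < Lam := hlam.trans_le hLam
  refine ⟨lam * (Lam ^ n)⁻¹, max (lam ^ n)⁻¹ (2 * Lam * (lam ^ n)⁻¹), by positivity, ?_⟩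
  filter_upwards [ha.herm, hb] with z hz hbz
  obtain ⟨d, hd, hd1, hd2, -⟩ := exists_det_inv_eq hn hz hlam hbz
  have hd0 : 0 < d := lt_of_lt_of_le (by positivity) hd1
  have hdz : detLower a z = d := hd
  have hnd : ‖detLower a z‖ = d := by rw [hdz, Complex.norm_real, Real.norm_of_nonneg hd0.le]
  refine ⟨?_, by rw [hdz, Complex.conj_ofReal], fun i j => ?_, fun i j => ?_, fun ξ => ?_⟩
  · rw [hnd]; exact hd2.trans (le_max_left _ _)
  · rw [coeff, norm_mul, hnd]
    refine le_trans ?_ (le_max_right _ _)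
    gcongr
    exact norm_entry_le hz hlam hbz i j
  · rw [coeff, coeff, map_mul, hdz, Complex.conj_ofReal]
    congr 1
    exact hz.apply j i
  · have h1 := (hbz fun i => conj (ξ i)).1
    simp only [RCLike.norm_conj, Complex.conj_conj] at h1
    have h2 : ∑ i, ∑ j, coeff a i j z * conj (ξ i) * ξ j =
        d * ∑ i, ∑ j, a z i j * conj (ξ i) * ξ j := by
      simp only [Finset.mul_sum, coeff, hdz]
      refine Finset.sum_congr rfl fun i _ => Finset.sum_congr rfl fun j _ => by ring
    rw [h2, Complex.re_ofReal_mul]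
    have h3 : 0 ≤ lam * ∑ i, ‖ξ i‖ ^ 2 := by positivity
    calc _ = (Lam ^ n)⁻¹ * (lam * ∑ i, ‖ξ i‖ ^ 2) := by ring
      _ ≤ d * (lam * ∑ i, ‖ξ i‖ ^ 2) := by gcongr
      _ ≤ _ := by gcongr

end HermitianDirichlet

namespace HermitianDirichlet

variable {n : ℕ}

/-! ### The class of admissible functions -/

section LpLimits

variable {α : Type*} [MeasurableSpace α] {μ : Measure α}

lemma tendsto_eLpNorm_linearComb {f g : ℕ → α → ℂ} {u v : α → ℂ} (c d : ℂ)
    (hf : ∀ k, AEStronglyMeasurable (f k) μ) (hg : ∀ k, AEStronglyMeasurable (g k) μ)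
    (hu : AEStronglyMeasurable u μ) (hv : AEStronglyMeasurable v μ)
    (hfu : Tendsto (fun k => eLpNorm (fun z => f k z - u z) 2 μ) atTop (𝓝 0))
    (hgv : Tendsto (fun k => eLpNorm (fun z => g k z - v z) 2 μ) atTop (𝓝 0)) :
    Tendsto (fun k => eLpNorm (fun z => (c * f k z + d * g k z) - (c * u z + d * v z)) 2 μ)
      atTop (𝓝 0) := by
  have h1 := ENNReal.Tendsto.const_mul hfu (Or.inr (enorm_ne_top (x := c)))
  have h2 := ENNReal.Tendsto.const_mul hgv (Or.inr (enorm_ne_top (x := d)))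
  have h := h1.add h2
  rw [mul_zero, mul_zero, add_zero] at h
  refine tendsto_of_tendsto_of_tendsto_of_le_of_le tendsto_const_nhds h (fun _ => zero_le)
    fun k => ?_
  have e : (fun z => (c * f k z + d * g k z) - (c * u z + d * v z)) =
      (c • fun z => f k z - u z) + d • fun z => g k z - v z := by
    ext z; simp; ring
  rw [e]
  refine (eLpNorm_add_le (((hf k).sub hu).const_smul c) (((hg k).sub hv).const_smul d)
    (by norm_num)).trans_eq ?_
  rw [eLpNorm_const_smul, eLpNorm_const_smul]
  rfl

lemma tendsto_eLpNorm_conj {f : ℕ → α → ℂ} {u : α → ℂ}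
    (hfu : Tendsto (fun k => eLpNorm (fun z => f k z - u z) 2 μ) atTop (𝓝 0)) :
    Tendsto (fun k => eLpNorm (fun z => conj (f k z) - conj (u z)) 2 μ) atTop (𝓝 0) := by
  refine hfu.congr fun k => eLpNorm_congr_norm_ae (Eventually.of_forall fun z => ?_)
  rw [← map_sub, RCLike.norm_conj]

lemma tendsto_eLpNorm_congr_ae {f : ℕ → α → ℂ} {u v : α → ℂ} (h : u =ᵐ[μ] v)
    (hfu : Tendsto (fun k => eLpNorm (fun z => f k z - u z) 2 μ) atTop (𝓝 0)) :
    Tendsto (fun k => eLpNorm (fun z => f k z - v z) 2 μ) atTop (𝓝 0) := by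
  refine hfu.congr fun k => eLpNorm_congr_ae ?_
  filter_upwards [h] with z hz
  rw [hz]

end LpLimits

lemma memLp_conj {α : Type*} [MeasurableSpace α] {μ : Measure α} {f : α → ℂ} (hf : MemLp f 2 μ) :
    MemLp (fun z => conj (f z)) 2 μ :=
  hf.star

lemma wirtinger_linearComb {f g : Cn n → ℂ} (hf : ContDiff ℝ ∞ f) (hg : ContDiff ℝ ∞ g)
    (c d s : ℂ) (i : Fin n) (z : Cn n) :
    wirtinger s i (fun z => c * f z + d * g z) z = c * wirtinger s i f z + d * wirtinger s i g z := by
  rw [wirtinger_add (contDiff_const.mul hf) (contDiff_const.mul hg), wirtinger_const_mul hf,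
    wirtinger_const_mul hg]

section

variable {u v : Cn n → ℂ} {p q p' q' : Fin n → Cn n → ℂ}

lemma IsTest.integrable_mul {φ : Cn n → ℂ} (hφ : IsTest φ) (hu : MemLp u 2 (volD n)) :
    Integrable (fun z => u z * φ z) (volD n) :=
  hu.integrable_mul hφ.memLp

lemma IsTest.del {φ : Cn n → ℂ} (hφ : IsTest φ) (i : Fin n) : IsTest (del i φ) := by
  rw [del_eq_wirtinger]; exact hφ.wirtinger _ i

lemma IsTest.delbar {φ : Cn n → ℂ} (hφ : IsTest φ) (i : Fin n) : IsTest (delbar i φ) :=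
  hφ.wirtinger _ i

lemma contDiff_del {f : Cn n → ℂ} (hf : ContDiff ℝ ∞ f) (i : Fin n) : ContDiff ℝ ∞ (del i f) := by
  rw [del_eq_wirtinger]; exact contDiff_wirtinger hf _ i

lemma contDiff_delbar {f : Cn n → ℂ} (hf : ContDiff ℝ ∞ f) (i : Fin n) :
    ContDiff ℝ ∞ (delbar i f) :=
  contDiff_wirtinger hf _ i

lemma IsW12.linearComb (hu : IsW12 u p q) (hv : IsW12 v p' q') (c d : ℂ) :
    IsW12 (fun z => c * u z + d * v z) (fun i z => c * p i z + d * p' i z)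
      fun i z => c * q i z + d * q' i z := by
  have key {f g φ : Cn n → ℂ} (hf : MemLp f 2 (volD n)) (hg : MemLp g 2 (volD n))
      (hφ : IsTest φ) : ∫ z in D n, (c * f z + d * g z) * φ z =
        c * (∫ z in D n, f z * φ z) + d * ∫ z in D n, g z * φ z := by
    rw [← integral_const_mul, ← integral_const_mul, ← integral_add
      ((hφ.integrable_mul hf).const_mul c) ((hφ.integrable_mul hg).const_mul d)]
    congr 1; ext z; ring
  refine ⟨(hu.memLp.const_mul c).add (hv.memLp.const_mul d),
    fun i => ((hu.memLp_del i).const_mul c).add ((hv.memLp_del i).const_mul d),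
    fun i => ((hu.memLp_delbar i).const_mul c).add ((hv.memLp_delbar i).const_mul d),
    fun i φ hφ => ?_, fun i φ hφ => ?_⟩
  · rw [key hu.memLp hv.memLp (hφ.del i), key (hu.memLp_del i) (hv.memLp_del i) hφ,
      hu.weak_del i φ hφ, hv.weak_del i φ hφ]
    ring
  · rw [key hu.memLp hv.memLp (hφ.delbar i), key (hu.memLp_delbar i) (hv.memLp_delbar i) hφ,
      hu.weak_delbar i φ hφ, hv.weak_delbar i φ hφ]
    ring

lemma IsW12.conjugate (hu : IsW12 u p q) :
    IsW12 (fun z => conj (u z)) (fun i z => conj (q i z)) fun i z => conj (p i z) := by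
  have key (f φ : Cn n → ℂ) : ∫ z in D n, conj (f z) * φ z =
      conj (∫ z in D n, f z * conj (φ z)) := by
    rw [← integral_conj]
    simp
  refine ⟨memLp_conj hu.memLp, fun i => memLp_conj (hu.memLp_delbar i),
    fun i => memLp_conj (hu.memLp_del i), fun i φ hφ => ?_, fun i φ hφ => ?_⟩
  · rw [key, key, ← map_neg, ← hu.weak_delbar i _ hφ.conjugate]
    simp only [delbar_conj hφ.smooth]
  · rw [key, key, ← map_neg, ← hu.weak_del i _ hφ.conjugate]
    simp only [del_conj hφ.smooth]

lemma integral_mul_congr_ae {f g : Cn n → ℂ} (h : f =ᵐ[volD n] g) (φ : Cn n → ℂ) :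
    ∫ z in D n, f z * φ z = ∫ z in D n, g z * φ z :=
  integral_congr_ae (h.mul EventuallyEq.rfl)

lemma IsW12.congr_ae (hu : IsW12 u p q) (huv : u =ᵐ[volD n] v) (hp : ∀ i, p i =ᵐ[volD n] p' i)
    (hq : ∀ i, q i =ᵐ[volD n] q' i) : IsW12 v p' q' := by
  refine ⟨(memLp_congr_ae huv).1 hu.memLp, fun i => (memLp_congr_ae (hp i)).1 (hu.memLp_del i),
    fun i => (memLp_congr_ae (hq i)).1 (hu.memLp_delbar i), fun i φ hφ => ?_, fun i φ hφ => ?_⟩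
  · rw [← integral_mul_congr_ae huv, ← integral_mul_congr_ae (hp i), hu.weak_del i φ hφ]
  · rw [← integral_mul_congr_ae huv, ← integral_mul_congr_ae (hq i), hu.weak_delbar i φ hφ]

variable {h h' : bdD n → ℂ}

lemma Admissible.linearComb (hu : Admissible h u p q) (hv : Admissible h' v p' q') (c d : ℂ) :
    Admissible (fun x => c * h x + d * h' x) (fun z => c * u z + d * v z)
      (fun i z => c * p i z + d * p' i z) fun i z => c * q i z + d * q' i z := by
  obtain ⟨huW, hh, f, hf, hfu, hfp, hfq, hfh⟩ := hu
  obtain ⟨hvW, hh', g, hg, hgv, hgp, hgq, hgh⟩ := hv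
  refine ⟨huW.linearComb hvW c d, (hh.const_mul c).add (hh'.const_mul d),
    fun k z => c * f k z + d * g k z,
    fun k => (contDiff_const.mul (hf k)).add (contDiff_const.mul (hg k)), ?_, fun i => ?_,
    fun i => ?_, ?_⟩
  · exact tendsto_eLpNorm_linearComb c d (fun k => (hf k).continuous.aestronglyMeasurable)
      (fun k => (hg k).continuous.aestronglyMeasurable) huW.memLp.1 hvW.memLp.1 hfu hgv
  · have := tendsto_eLpNorm_linearComb c d
      (fun k => (contDiff_del (hf k) i).continuous.aestronglyMeasurable)
      (fun k => (contDiff_del (hg k) i).continuous.aestronglyMeasurable)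
      (huW.memLp_del i).1 (hvW.memLp_del i).1 (hfp i) (hgp i)
    simp only [del_eq_wirtinger, wirtinger_linearComb (hf _) (hg _)] at this ⊢
    exact this
  · have := tendsto_eLpNorm_linearComb c d
      (fun k => (contDiff_delbar (hf k) i).continuous.aestronglyMeasurable)
      (fun k => (contDiff_delbar (hg k) i).continuous.aestronglyMeasurable)
      (huW.memLp_delbar i).1 (hvW.memLp_delbar i).1 (hfq i) (hgq i)
    simp only [delbar_eq_wirtinger, wirtinger_linearComb (hf _) (hg _)] at this ⊢
    exact this
  · exact tendsto_eLpNorm_linearComb c d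
      (fun k => ((hf k).continuous.comp continuous_subtype_val).aestronglyMeasurable)
      (fun k => ((hg k).continuous.comp continuous_subtype_val).aestronglyMeasurable)
      hh.1 hh'.1 hfh hgh

lemma Admissible.conjugate (hu : Admissible h u p q) :
    Admissible (fun x => conj (h x)) (fun z => conj (u z)) (fun i z => conj (q i z))
      fun i z => conj (p i z) := by
  obtain ⟨huW, hh, f, hf, hfu, hfp, hfq, hfh⟩ := hu
  refine ⟨huW.conjugate, memLp_conj hh, fun k z => conj (f k z), fun k => contDiff_conj (hf k),
    tendsto_eLpNorm_conj hfu, fun i => ?_, fun i => ?_, tendsto_eLpNorm_conj hfh⟩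
  · simp only [del_conj (hf _)]
    exact tendsto_eLpNorm_conj (hfq i)
  · simp only [delbar_conj (hf _)]
    exact tendsto_eLpNorm_conj (hfp i)

lemma Admissible.congr_ae (hu : Admissible h u p q) (huv : u =ᵐ[volD n] v)
    (hp : ∀ i, p i =ᵐ[volD n] p' i) (hq : ∀ i, q i =ᵐ[volD n] q' i) : Admissible h v p' q' := by
  obtain ⟨huW, hh, f, hf, hfu, hfp, hfq, hfh⟩ := hu
  exact ⟨huW.congr_ae huv hp hq, hh, f, hf, tendsto_eLpNorm_congr_ae huv hfu,
    fun i => tendsto_eLpNorm_congr_ae (hp i) (hfp i),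
    fun i => tendsto_eLpNorm_congr_ae (hq i) (hfq i), hfh⟩

/-- If the boundary values are real, the real part of an admissible function is admissible. -/
lemma Admissible.exists_real {h : bdD n → ℝ} (hu : Admissible (fun x => (h x : ℂ)) u p q) :
    ∃ p' q', Admissible (fun x => (h x : ℂ)) (fun z => ((u z).re : ℂ)) p' q' := by
  have h1 := hu.linearComb hu.conjugate (1 / 2) (1 / 2)
  have e1 : (fun x => 1 / 2 * (h x : ℂ) + 1 / 2 * conj (h x : ℂ)) = fun x => (h x : ℂ) := by
    ext x
    rw [Complex.conj_ofReal]
    ring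
  have e2 : (fun z => 1 / 2 * u z + 1 / 2 * conj (u z)) = fun z => ((u z).re : ℂ) := by
    ext z
    rw [← mul_add, Complex.add_conj]
    push_cast
    ring
  rw [e1, e2] at h1
  exact ⟨_, _, h1⟩

end

end HermitianDirichlet

namespace HermitianDirichlet

/-! ### Quadratic functionals on a Hilbert space -/

section Abstract

variable {H : Type*} [NormedAddCommGroup H] [InnerProductSpace ℝ H]

lemma quadratic_add {B : H →L[ℝ] H →L[ℝ] ℝ} (hsymm : ∀ x y, B x y = B y x) (ℓ : H →L[ℝ] ℝ)
    (x y : H) :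
    B (x + y) (x + y) - 2 * ℓ (x + y) = (B x x - 2 * ℓ x) + 2 * (B x y - ℓ y) + B y y := by
  simp only [map_add, add_apply, hsymm y x]
  ring

/-- The Euler–Lagrange equation. -/
lemma apply_eq_of_forall_le {B : H →L[ℝ] H →L[ℝ] ℝ} (hsymm : ∀ x y, B x y = B y x)
    (ℓ : H →L[ℝ] ℝ) {x y : H}
    (h : ∀ t : ℝ, B x x - 2 * ℓ x ≤ B (x + t • y) (x + t • y) - 2 * ℓ (x + t • y)) :
    B x y = ℓ y := by
  have h1 (t : ℝ) : 0 ≤ B y y * (t * t) + 2 * (B x y - ℓ y) * t + 0 := by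
    have h2 := h t
    rw [quadratic_add hsymm] at h2
    simp only [map_smul, smul_apply, smul_eq_mul] at h2
    linarith
  have h3 := discrim_le_zero h1
  rw [discrim] at h3
  have h4 : B x y - ℓ y = 0 := by nlinarith [sq_nonneg (B x y - ℓ y)]
  linarith

/-- The direct method, through the Lax–Milgram theorem: a quadratic functional that is coercive
on a closed subspace attains its minimum on each translate of the subspace. -/
lemma exists_forall_le_of_coercive [CompleteSpace H] {B : H →L[ℝ] H →L[ℝ] ℝ}
    (hsymm : ∀ x y, B x y = B y x) (ℓ : H →L[ℝ] ℝ) {V : Submodule ℝ H}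
    (hV : IsClosed (V : Set H)) {c : ℝ} (hc : 0 < c) (hB : ∀ v ∈ V, c * ‖v‖ ^ 2 ≤ B v v) (w : H) :
    ∃ x, x - w ∈ V ∧ ∀ y, y - w ∈ V → B x x - 2 * ℓ x ≤ B y y - 2 * ℓ y := by
  have : CompleteSpace V := hV.completeSpace_coe
  set BV : V →L[ℝ] V →L[ℝ] ℝ := B.bilinearComp V.subtypeL V.subtypeL with hBV
  have hco : IsCoercive BV := ⟨c, hc, fun v => by
    have := hB v v.2
    simpa [hBV, mul_assoc, pow_two] using this⟩
  set L : V →L[ℝ] ℝ := (ℓ - B w).comp V.subtypeL with hL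
  set v : V := hco.continuousLinearEquivOfBilin.symm ((InnerProductSpace.toDual ℝ V).symm L)
    with hv
  have hEL (y : V) : B v y = ℓ y - B w y := by
    have h1 := hco.continuousLinearEquivOfBilin_apply v y
    rw [hv, ContinuousLinearEquiv.apply_symm_apply, InnerProductSpace.toDual_symm_apply] at h1
    exact h1.symm
  refine ⟨w + v, by simp, fun y hy => ?_⟩
  have hd : y - (w + v) ∈ V := by
    rw [← sub_sub]
    exact V.sub_mem hy v.2
  have h2 := hEL ⟨_, hd⟩
  have h3 := quadratic_add hsymm ℓ (w + v) (y - (w + v))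
  rw [add_sub_cancel] at h3
  have h4 := hB _ hd
  have h5 : 0 ≤ c * ‖y - (w + v)‖ ^ 2 := by positivity
  have h6 : B (w + v) (y - (w + v)) = ℓ (y - (w + v)) := by
    rw [map_add, add_apply]
    simp only at h2
    linarith
  rw [h6] at h3
  linarith

end Abstract

end HermitianDirichlet

namespace HermitianDirichlet

variable {n : ℕ}

/-! ### The Hilbert space of first-order jets -/

/-- The Hilbert space of triples `(u, p, q)` of a function in `L²(D)` and candidates in `L²(D)` for
its derivatives `∂ᵢu` and `∂_{ī}u`: the components with index `none`, `inl i` and `inr i`. -/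
abbrev Jet (n : ℕ) : Type := PiLp 2 fun _ : Option (Fin n ⊕ Fin n) => Lp ℂ 2 (volD n)

/-- The functions `u`, `p`, `q` represent the classes that form the triple `X`. -/
structure Represents (X : Jet n) (u : Cn n → ℂ) (p q : Fin n → Cn n → ℂ) : Prop where
  fst : X none =ᵐ[volD n] u
  del : ∀ i, X (some (.inl i)) =ᵐ[volD n] p i
  delbar : ∀ i, X (some (.inr i)) =ᵐ[volD n] q i

variable {X Y : Jet n} {u v : Cn n → ℂ} {p q p' q' : Fin n → Cn n → ℂ}

lemma represents_self (X : Jet n) :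
    Represents X (X none) (fun i => X (some (.inl i))) fun i => X (some (.inr i)) :=
  ⟨.rfl, fun _ => .rfl, fun _ => .rfl⟩

lemma exists_represents (hu : MemLp u 2 (volD n)) (hp : ∀ i, MemLp (p i) 2 (volD n))
    (hq : ∀ i, MemLp (q i) 2 (volD n)) : ∃ X : Jet n, Represents X u p q :=
  ⟨WithLp.toLp 2 fun k => match k with
    | none => hu.toLp u
    | some (.inl i) => (hp i).toLp (p i)
    | some (.inr i) => (hq i).toLp (q i),
    hu.coeFn_toLp, fun i => (hp i).coeFn_toLp, fun i => (hq i).coeFn_toLp⟩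

lemma IsW12.exists_represents (hu : IsW12 u p q) : ∃ X : Jet n, Represents X u p q :=
  HermitianDirichlet.exists_represents hu.memLp hu.memLp_del hu.memLp_delbar

lemma IsTest.exists_represents {φ : Cn n → ℂ} (hφ : IsTest φ) :
    ∃ X : Jet n, Represents X φ (fun i => HermitianDirichlet.del i φ)
      fun i => HermitianDirichlet.delbar i φ :=
  HermitianDirichlet.exists_represents hφ.memLp (fun i => (hφ.del i).memLp)
    fun i => (hφ.delbar i).memLp

lemma Represents.linearComb (hX : Represents X u p q) (hY : Represents Y v p' q') (c d : ℝ) :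
    Represents (c • X + d • Y) (fun z => c * u z + d * v z) (fun i z => c * p i z + d * p' i z)
      fun i z => c * q i z + d * q' i z := by
  have key {f g : Lp ℂ 2 (volD n)} {f' g' : Cn n → ℂ} (hf : f =ᵐ[volD n] f')
      (hg : g =ᵐ[volD n] g') :
      (c • f + d • g : Lp ℂ 2 (volD n)) =ᵐ[volD n] fun z => c * f' z + d * g' z := by
    filter_upwards [hf, hg, Lp.coeFn_add (c • f) (d • g), Lp.coeFn_smul c f, Lp.coeFn_smul d g]
      with z h1 h2 h3 h4 h5
    rw [h3, Pi.add_apply, h4, h5, Pi.smul_apply, Pi.smul_apply, h1, h2, Complex.real_smul,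
      Complex.real_smul]
  exact ⟨key hX.fst hY.fst, fun i => key (hX.del i) (hY.del i),
    fun i => key (hX.delbar i) (hY.delbar i)⟩

/-- Triples given by test functions. -/
def testJets (n : ℕ) : Submodule ℝ (Jet n) where
  carrier := {X | ∃ φ, IsTest φ ∧
    Represents X φ (fun i => del i φ) fun i => delbar i φ}
  zero_mem' := by
    refine ⟨fun _ => 0, .zero, Lp.coeFn_zero _ _ _, fun i => ?_, fun i => ?_⟩
    · refine (Lp.coeFn_zero _ _ _).trans (Eventually.of_forall fun z => ?_)
      simp [del]
    · refine (Lp.coeFn_zero _ _ _).trans (Eventually.of_forall fun z => ?_)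
      simp [delbar]
  add_mem' := by
    rintro X Y ⟨φ, hφ, hX⟩ ⟨ψ, hψ, hY⟩
    refine ⟨fun z => φ z + ψ z, hφ.add hψ, ?_⟩
    have := hX.linearComb hY 1 1
    simp only [del_eq_wirtinger, delbar_eq_wirtinger, one_smul, Complex.ofReal_one, one_mul,
      ← wirtinger_add hφ.smooth hψ.smooth] at this ⊢
    exact this
  smul_mem' := by
    rintro c X ⟨φ, hφ, hX⟩
    refine ⟨fun z => c * φ z, hφ.const_mul c, ?_⟩
    have := hX.linearComb hX c 0
    simp only [zero_smul, Complex.ofReal_zero, zero_mul, add_zero] at this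
    simp only [del_eq_wirtinger, delbar_eq_wirtinger, ← wirtinger_const_mul hφ.smooth] at this ⊢
    exact this

/-- The space `W^{1,2}_0(D)`: the closure of the test functions. -/
def zeroJets (n : ℕ) : Submodule ℝ (Jet n) := (testJets n).topologicalClosure

lemma isClosed_zeroJets (n : ℕ) : IsClosed (zeroJets n : Set (Jet n)) :=
  Submodule.isClosed_topologicalClosure _

lemma mem_zeroJets_of_isTest {φ : Cn n → ℂ} (hφ : IsTest φ)
    (hX : Represents X φ (fun i => del i φ) fun i => delbar i φ) : X ∈ zeroJets n :=
  Submodule.le_topologicalClosure _ ⟨φ, hφ, hX⟩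

lemma zeroJets_induction {P : Jet n → Prop} (hP : IsClosed {X | P X})
    (h : ∀ φ X, IsTest φ → Represents X φ (fun i => del i φ) (fun i => delbar i φ) → P X)
    (hX : X ∈ zeroJets n) : P X := by
  have hsub : (testJets n : Set (Jet n)) ⊆ {X | P X} := by
    rintro Y ⟨φ, hφ, hY⟩
    exact h φ Y hφ hY
  exact closure_minimal hsub hP hX

lemma continuous_component (k : Option (Fin n ⊕ Fin n)) : Continuous fun X : Jet n => X k :=
  PiLp.continuous_apply 2 _ k

/-- Differences of admissible functions lie in `W^{1,2}_0(D)`. -/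
lemma Admissible.sub_mem_zeroJets (hn : 0 < n) {h : bdD n → ℂ} (hu : Admissible h u p q)
    (hv : Admissible h v p' q') (hX : Represents X u p q) (hY : Represents Y v p' q') :
    X - Y ∈ zeroJets n := by
  have hd := hu.linearComb hv 1 (-1)
  have hZ := hX.linearComb hY 1 (-1)
  simp only [one_smul, neg_smul, ← sub_eq_add_neg, Complex.ofReal_one, Complex.ofReal_neg] at hZ
  have h0 : (fun x => 1 * h x + -1 * h x) = fun _ => 0 := by ext x; ring
  rw [h0] at hd
  choose φ hφ hφu hφp hφq using fun m : ℕ => hd.2.exists_isTest_approx hn hd.1.memLp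
    hd.1.memLp_del hd.1.memLp_delbar (η := 1 / ((m : ℝ) + 1)) (by positivity)
  choose Φ hΦ using fun m => (hφ m).exists_represents
  have hlim : Tendsto (fun m : ℕ => ENNReal.ofReal (1 / ((m : ℝ) + 1))) atTop (𝓝 0) := by
    simpa using ENNReal.tendsto_ofReal (tendsto_one_div_add_atTop_nhds_zero_nat (𝕜 := ℝ))
  have key {f : ℕ → Lp ℂ 2 (volD n)} {g : Lp ℂ 2 (volD n)} {f' : ℕ → Cn n → ℂ} {g' : Cn n → ℂ}
      (hf : ∀ m, f m =ᵐ[volD n] f' m) (hg : g =ᵐ[volD n] g')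
      (h : ∀ m : ℕ, eLpNorm (fun z => f' m z - g' z) 2 (volD n) ≤
        ENNReal.ofReal (1 / ((m : ℝ) + 1))) : Tendsto f atTop (𝓝 g) := by
    rw [Lp.tendsto_Lp_iff_tendsto_eLpNorm']
    refine tendsto_of_tendsto_of_tendsto_of_le_of_le tendsto_const_nhds hlim (fun _ => zero_le)
      fun m => ?_
    refine (eLpNorm_congr_ae ?_).trans_le (h m)
    exact (hf m).sub hg
  have hT : Tendsto Φ atTop (𝓝 (X - Y)) := by
    have : Tendsto (fun m k => Φ m k) atTop (𝓝 fun k => (X - Y) k) := by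
      refine tendsto_pi_nhds.2 fun k => ?_
      rcases k with _ | i | i
      · exact key (fun m => (hΦ m).fst) hZ.fst hφu
      · exact key (fun m => (hΦ m).del i) (hZ.del i) fun m => hφp m i
      · exact key (fun m => (hΦ m).delbar i) (hZ.delbar i) fun m => hφq m i
    exact ((PiLp.continuous_toLp 2 _).tendsto _).comp this
  exact (isClosed_zeroJets n).mem_of_tendsto hT
    (Eventually.of_forall fun m => mem_zeroJets_of_isTest (hφ m) (hΦ m))

lemma continuous_integral_mul {g : Cn n → ℂ} (hg : MemLp g 2 (volD n)) :
    Continuous fun f : Lp ℂ 2 (volD n) => ∫ z in D n, f z * g z := by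
  have h (f : Lp ℂ 2 (volD n)) : ∫ z in D n, f z * g z =
      inner ℂ ((memLp_conj hg).toLp _) f := by
    rw [L2.inner_def]
    refine integral_congr_ae ?_
    filter_upwards [(memLp_conj hg).coeFn_toLp] with z hz
    rw [hz]
    simp [mul_comm]
  simp only [h]
  fun_prop

/-- Elements of `W^{1,2}_0(D)` are weakly differentiable, with vanishing trace. -/
lemma admissible_zero_of_mem_zeroJets (hX : X ∈ zeroJets n) :
    Admissible (fun _ => 0) (X none) (fun i => X (some (.inl i))) fun i => X (some (.inr i)) := by
  refine ⟨⟨Lp.memLp _, fun i => Lp.memLp _, fun i => Lp.memLp _, fun i φ hφ => ?_,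
    fun i φ hφ => ?_⟩, ?_⟩
  · refine zeroJets_induction (P := fun X => ∫ z in D n, X none z * del i φ z =
      -∫ z in D n, X (some (.inl i)) z * φ z) ?_ (fun ψ Y hψ hY => ?_) hX
    · exact isClosed_eq ((continuous_integral_mul (hφ.del i).memLp).comp (continuous_component _))
        ((continuous_integral_mul hφ.memLp).comp (continuous_component _)).neg
    · rw [integral_mul_congr_ae hY.fst, integral_mul_congr_ae (hY.del i)]
      simp only [del_eq_wirtinger]
      exact hφ.integral_mul_wirtinger hψ.smooth _ i
  · refine zeroJets_induction (P := fun X => ∫ z in D n, X none z * delbar i φ z =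
      -∫ z in D n, X (some (.inr i)) z * φ z) ?_ (fun ψ Y hψ hY => ?_) hX
    · exact isClosed_eq ((continuous_integral_mul (hφ.delbar i).memLp).comp
        (continuous_component _))
        ((continuous_integral_mul hφ.memLp).comp (continuous_component _)).neg
    · rw [integral_mul_congr_ae hY.fst, integral_mul_congr_ae (hY.delbar i)]
      simp only [delbar_eq_wirtinger]
      exact hφ.integral_mul_wirtinger hψ.smooth _ i
  · refine ⟨MemLp.zero', ?_⟩
    obtain ⟨Φ, hΦT, hΦ⟩ := mem_closure_iff_seq_limit.1 hX
    choose φ hφ hφΦ using hΦT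
    have key {f' : ℕ → Cn n → ℂ} (k : Option (Fin n ⊕ Fin n))
        (hf : ∀ m, Φ m k =ᵐ[volD n] f' m) :
        Tendsto (fun m => eLpNorm (fun z => f' m z - X k z) 2 (volD n)) atTop (𝓝 0) := by
      have h1 := (Lp.tendsto_Lp_iff_tendsto_eLpNorm' _ _).1
        (((continuous_component k).tendsto X).comp hΦ)
      refine h1.congr fun m => eLpNorm_congr_ae ?_
      exact (hf m).sub EventuallyEq.rfl
    refine ⟨φ, fun k => (hφ k).smooth, key _ fun m => (hφΦ m).fst,
      fun i => key _ fun m => (hφΦ m).del i, fun i => key _ fun m => (hφΦ m).delbar i, ?_⟩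
    have h0 (k : ℕ) (x : bdD n) : φ k x = 0 := (hφ k).eq_zero (by simp)
    simp [h0]

lemma Admissible.add_mem_zeroJets {h : bdD n → ℂ} (hu : Admissible h u p q)
    (hX : Represents X u p q) (hYX : Y - X ∈ zeroJets n) (hY : Represents Y v p' q') :
    Admissible h v p' q' := by
  have h1 := hu.linearComb (admissible_zero_of_mem_zeroJets hYX) 1 1
  have h2 := hX.linearComb (represents_self (Y - X)) 1 1
  simp only [one_smul, add_sub_cancel, Complex.ofReal_one] at h2
  simp only [mul_zero, add_zero, one_mul] at h1 h2
  exact h1.congr_ae (h2.fst.symm.trans hY.fst) (fun i => (h2.del i).symm.trans (hY.del i))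
    fun i => (h2.delbar i).symm.trans (hY.delbar i)

/-! ### Coercivity -/

lemma norm_sq_eq_integral {f : Lp ℂ 2 (volD n)} {g : Cn n → ℂ} (h : f =ᵐ[volD n] g) :
    ‖f‖ ^ 2 = ∫ z in D n, ‖g z‖ ^ 2 := by
  rw [← real_inner_self_eq_norm_sq, L2.inner_def]
  refine integral_congr_ae ?_
  filter_upwards [h] with z hz
  rw [hz, real_inner_self_eq_norm_sq]

/-- On `W^{1,2}_0(D)`, the `L²` norm of `∂̄u` controls the full norm. -/
lemma norm_sq_le_of_mem_zeroJets (hn : 0 < n) (hX : X ∈ zeroJets n) :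
    ‖X‖ ^ 2 ≤ 6 * ∑ i, ‖X (some (.inr i))‖ ^ 2 := by
  refine zeroJets_induction (P := fun X : Jet n => ‖X‖ ^ 2 ≤ 6 * ∑ i, ‖X (some (.inr i))‖ ^ 2)
    ?_ (fun φ X hφ hX => ?_) hX
  · refine isClosed_le (by fun_prop) (continuous_const.mul
      (continuous_finsetSum _ fun i _ => ((continuous_component _).norm.pow 2)))
  · have h1 (i : Fin n) : ‖X (some (.inl i))‖ ^ 2 = ‖X (some (.inr i))‖ ^ 2 := by
      rw [norm_sq_eq_integral (hX.del i), norm_sq_eq_integral (hX.delbar i),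
        hφ.integral_norm_sq_del i]
    have h2 : ‖X none‖ ^ 2 ≤ 4 * ‖X (some (.inr ⟨0, hn⟩))‖ ^ 2 := by
      rw [norm_sq_eq_integral hX.fst, norm_sq_eq_integral (hX.delbar _)]
      exact hφ.integral_norm_sq_le _
    have h3 : ‖X (some (.inr ⟨0, hn⟩))‖ ^ 2 ≤ ∑ i, ‖X (some (.inr i))‖ ^ 2 :=
      Finset.single_le_sum (f := fun i => ‖X (some (.inr i))‖ ^ 2) (fun i _ => by positivity)
        (Finset.mem_univ (⟨0, hn⟩ : Fin n))
    rw [PiLp.norm_sq_eq_of_L2, Fintype.sum_option, Fintype.sum_sum_type]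
    simp only [h1]
    linarith

end HermitianDirichlet

namespace HermitianDirichlet

variable {n : ℕ}

/-! ### The energy as a quadratic functional -/

instance isFiniteMeasure_volD (n : ℕ) : IsFiniteMeasure (volD n) :=
  isFiniteMeasure_restrict.2 measure_ball_lt_top.ne

lemma exists_mul_continuousLinearMap {c : Cn n → ℂ} (hc : MemLp c ⊤ (volD n)) :
    ∃ T : Lp ℂ 2 (volD n) →L[ℝ] Lp ℂ 2 (volD n), ∀ f, T f =ᵐ[volD n] fun z => c z * f z := by
  refine ⟨(ContinuousLinearMap.mul ℝ ℂ).holderL (volD n) ⊤ 2 2 (hc.toLp c), fun f => ?_⟩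
  refine ((ContinuousLinearMap.mul ℝ ℂ).coeFn_holder (r := 2) (hc.toLp c) f).trans ?_
  filter_upwards [hc.coeFn_toLp] with z hz
  simp [hz]

variable {a : Cn n → Matrix (Fin n) (Fin n) ℂ}

lemma IsUniformlyElliptic.memLp_detLower (hn : 0 < n) (ha : IsUniformlyElliptic a) :
    MemLp (detLower a) ⊤ (volD n) := by
  obtain ⟨c, M, -, h⟩ := ha.exists_bounds hn
  exact memLp_top_of_bound ha.aemeasurable_detLower.aestronglyMeasurable M
    (h.mono fun z hz => hz.1)

lemma IsUniformlyElliptic.memLp_coeff (hn : 0 < n) (ha : IsUniformlyElliptic a) (i j : Fin n) :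
    MemLp (coeff a i j) ⊤ (volD n) := by
  obtain ⟨c, M, -, h⟩ := ha.exists_bounds hn
  exact memLp_top_of_bound ((ha.meas i j).mul ha.aemeasurable_detLower).aestronglyMeasurable M
    (h.mono fun z hz => hz.2.2.1 i j)

lemma integrable_bounded_mul {c f : Cn n → ℂ} (hc : MemLp c ⊤ (volD n))
    (hf : Integrable f (volD n)) : Integrable (fun z => c z * f z) (volD n) :=
  memLp_one_iff_integrable.1 ((memLp_one_iff_integrable.2 hf).mul (r := 1) hc)

lemma IsUniformlyElliptic.integrable_form (hn : 0 < n) (ha : IsUniformlyElliptic a)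
    {f g : Fin n → Cn n → ℂ} (hf : ∀ i, MemLp (f i) 2 (volD n))
    (hg : ∀ i, MemLp (g i) 2 (volD n)) :
    Integrable (fun z => ∑ i, ∑ j, coeff a i j z * (f i z * g j z)) (volD n) :=
  integrable_finsetSum _ fun i _ => integrable_finsetSum _ fun j _ =>
    integrable_bounded_mul (ha.memLp_coeff hn i j) ((hf i).integrable_mul (hg j))

variable {X Y : Jet n} {u v : Cn n → ℂ} {p q p' q' : Fin n → Cn n → ℂ}

lemma Represents.memLp (hX : Represents X u p q) : MemLp u 2 (volD n) :=
  (memLp_congr_ae hX.fst).1 (Lp.memLp _)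

lemma Represents.memLp_delbar (hX : Represents X u p q) (i : Fin n) : MemLp (q i) 2 (volD n) :=
  (memLp_congr_ae (hX.delbar i)).1 (Lp.memLp _)

lemma exists_sesquilinear_form (hn : 0 < n) (ha : IsUniformlyElliptic a) :
    ∃ B : Jet n →L[ℝ] Jet n →L[ℝ] ℝ, ∀ {X Y : Jet n} {u v : Cn n → ℂ}
      {p q p' q' : Fin n → Cn n → ℂ}, Represents X u p q → Represents Y v p' q' →
      B X Y = ∫ z in D n, (∑ i, ∑ j, coeff a i j z * (conj (q i z) * q' j z)).re := by
  choose T hT using fun i j => exists_mul_continuousLinearMap (ha.memLp_coeff hn i j)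
  let P (i : Fin n) : Jet n →L[ℝ] Lp ℂ 2 (volD n) := PiLp.proj 2 _ (some (Sum.inr i))
  refine ⟨∑ i, ∑ j, (innerSL ℝ).bilinearComp (P i) ((T i j).comp (P j)),
    fun {X Y u v p q p' q'} hX hY => ?_⟩
  have hint (i j : Fin n) :
      Integrable (fun z => (coeff a i j z * (conj (q i z) * q' j z)).re) (volD n) :=
    (integrable_bounded_mul (ha.memLp_coeff hn i j)
      ((memLp_conj (hX.memLp_delbar i)).integrable_mul (hY.memLp_delbar j))).re
  simp only [Complex.re_sum]
  rw [integral_finsetSum _ fun i _ => integrable_finsetSum _ fun j _ => hint i j]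
  simp only [integral_finsetSum _ fun j _ => hint _ j, sum_apply,
    ContinuousLinearMap.bilinearComp_apply, ContinuousLinearMap.comp_apply]
  refine Finset.sum_congr rfl fun i _ => Finset.sum_congr rfl fun j _ => ?_
  rw [innerSL_apply_apply, L2.inner_def]
  refine integral_congr_ae ?_
  filter_upwards [hT i j (P j Y), hX.delbar i, hY.delbar j] with z h1 h2 h3
  have h2' : (P i X : Lp ℂ 2 (volD n)) z = q i z := h2
  have h3' : (P j Y : Lp ℂ 2 (volD n)) z = q' j z := h3
  rw [h1, h2', h3', Complex.inner]
  congr 1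
  ring

lemma exists_linear_form (hn : 0 < n) (ha : IsUniformlyElliptic a) (R : ℝ) :
    ∃ ℓ : Jet n →L[ℝ] ℝ, ∀ {X : Jet n} {u : Cn n → ℂ} {p q : Fin n → Cn n → ℂ},
      Represents X u p q → ℓ X = ∫ z in D n, ((R : ℂ) * detLower a z * u z).re := by
  have hg : MemLp (fun z => conj ((R : ℂ) * detLower a z)) 2 (volD n) :=
    memLp_conj (((ha.memLp_detLower hn).mono_exponent le_top).const_mul _)
  refine ⟨(innerSL ℝ (hg.toLp _)).comp (PiLp.proj 2 _ none : Jet n →L[ℝ] Lp ℂ 2 (volD n)),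
    fun {X u p q} hX => ?_⟩
  rw [ContinuousLinearMap.comp_apply, innerSL_apply_apply, L2.inner_def]
  refine integral_congr_ae ?_
  filter_upwards [hg.coeFn_toLp, hX.fst] with z h1 h2
  have h2' : (PiLp.proj 2 _ none : Jet n →L[ℝ] Lp ℂ 2 (volD n)) X z = u z := h2
  rw [h1, h2', Complex.inner, Complex.conj_conj, mul_comm]

/-- The energy is `B X X - 2 ℓ X` for a bounded symmetric bilinear form `B` and a bounded linear
form `ℓ` on the space of jets; `B X Φ = ℓ Φ` is the real part of the weak equation, tested against
the conjugate of `φ`. -/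
lemma exists_energy_forms (hn : 0 < n) (ha : IsUniformlyElliptic a) (R : ℝ) :
    ∃ (B : Jet n →L[ℝ] Jet n →L[ℝ] ℝ) (ℓ : Jet n →L[ℝ] ℝ) (c : ℝ), 0 < c ∧
      (∀ X Y, B X Y = B Y X) ∧ (∀ X ∈ zeroJets n, c * ‖X‖ ^ 2 ≤ B X X) ∧
      (∀ {X u p q}, Represents X u p q → energy a R u q = B X X - 2 * ℓ X) ∧
      ∀ {X Φ u p q φ}, Represents X u p q → IsTest φ →
        Represents Φ φ (fun i => del i φ) (fun i => delbar i φ) →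
        B X Φ = (weakLHS a q fun z => conj (φ z)).re ∧
        ℓ Φ = (weakRHS a R fun z => conj (φ z)).re := by
  obtain ⟨c, M, hc, hae⟩ := ha.exists_bounds hn
  obtain ⟨B, hB⟩ := exists_sesquilinear_form hn ha
  obtain ⟨ℓ, hℓ⟩ := exists_linear_form hn ha R
  have hsymm (X Y : Jet n) : B X Y = B Y X := by
    rw [hB (represents_self X) (represents_self Y), hB (represents_self Y) (represents_self X)]
    refine integral_congr_ae ?_
    filter_upwards [hae] with z hz
    rw [← Complex.conj_re]
    congr 1
    simp only [map_sum, map_mul, Complex.conj_conj, hz.2.2.2.1]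
    rw [Finset.sum_comm]
    refine Finset.sum_congr rfl fun i _ => Finset.sum_congr rfl fun j _ => by ring
  refine ⟨B, ℓ, c / 6, by positivity, hsymm, fun X hX => ?_, fun {X u p q} hX => ?_,
    fun {X Φ u p q φ} hX hφ hΦ => ⟨?_, ?_⟩⟩
  · have h1 : c * ∑ i, ‖X (some (.inr i))‖ ^ 2 ≤ B X X := by
      have hq (i : Fin n) : Integrable (fun z => ‖X (some (.inr i)) z‖ ^ 2) (volD n) :=
        (Lp.memLp (X (some (.inr i)))).integrable_norm_pow (by norm_num)
      rw [hB (represents_self X) (represents_self X), Finset.mul_sum]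
      simp only [norm_sq_eq_integral EventuallyEq.rfl, ← integral_const_mul]
      rw [← integral_finsetSum _ fun i _ => (hq i).const_mul c]
      refine integral_mono_ae (integrable_finsetSum _ fun i _ => (hq i).const_mul c)
        (ha.integrable_form hn (fun i => memLp_conj ((represents_self X).memLp_delbar i))
          (represents_self X).memLp_delbar).re ?_
      filter_upwards [hae] with z hz
      have := hz.2.2.2.2 fun i => X (some (.inr i)) z
      simpa only [mul_assoc, Finset.mul_sum] using this
    have h2 := norm_sq_le_of_mem_zeroJets hn hX
    calc c / 6 * ‖X‖ ^ 2 ≤ c / 6 * (6 * ∑ i, ‖X (some (.inr i))‖ ^ 2) := by gcongr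
      _ = c * ∑ i, ‖X (some (.inr i))‖ ^ 2 := by ring
      _ ≤ _ := h1
  · have hi1 : Integrable (fun z => (∑ i, ∑ j, coeff a i j z * (conj (q i z) * q j z)).re)
        (volD n) :=
      (ha.integrable_form hn (fun i => memLp_conj (hX.memLp_delbar i)) hX.memLp_delbar).re
    have hi2 : Integrable (fun z => ((R : ℂ) * detLower a z * u z).re) (volD n) := by
      have h := integrable_bounded_mul (ha.memLp_detLower hn)
        ((hX.memLp.integrable (by norm_num)).const_mul (R : ℂ))
      have h' : Integrable (fun z => (R : ℂ) * detLower a z * u z) (volD n) := by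
        refine h.congr (Eventually.of_forall fun z => ?_)
        simp only
        ring
      exact h'.re
    rw [hB hX hX, hℓ hX, ← integral_const_mul, ← integral_sub hi1 (hi2.const_mul 2), energy]
    refine integral_congr_ae ?_
    filter_upwards [hae] with z hz
    have him : (detLower a z).im = 0 := Complex.conj_eq_iff_im.1 hz.2.1
    have hs : (∑ i, ∑ j, a z i j * conj (q i z) * q j z) * detLower a z =
        ∑ i, ∑ j, coeff a i j z * (conj (q i z) * q j z) := by
      simp only [Finset.sum_mul, coeff]
      refine Finset.sum_congr rfl fun i _ => Finset.sum_congr rfl fun j _ => by ring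
    rw [sub_mul, hs, Complex.sub_re]
    congr 1
    simp [him]
    ring
  · rw [hsymm, hB hΦ hX, weakLHS]
    have hi := ha.integrable_form hn (f := fun i z => conj (delbar i φ z))
      (fun i => memLp_conj (hφ.delbar i).memLp) hX.memLp_delbar
    refine (integral_re hi).trans ?_
    rw [RCLike.re_eq_complex_re]
    congr 2
    ext z
    simp only [del_conj hφ.smooth, coeff]
    refine Finset.sum_congr rfl fun i _ => Finset.sum_congr rfl fun j _ => by ring
  · rw [hℓ hΦ, weakRHS]
    have hi : Integrable (fun z => (R : ℂ) * detLower a z * conj (φ z)) (volD n) := by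
      have h := integrable_bounded_mul (ha.memLp_detLower hn)
        (((memLp_conj hφ.memLp).integrable (by norm_num)).const_mul (R : ℂ))
      refine h.congr (Eventually.of_forall fun z => ?_)
      simp only
      ring
    refine Eq.trans ?_ (integral_re hi)
    refine integral_congr_ae ?_
    filter_upwards [hae] with z hz
    have him : (detLower a z).im = 0 := Complex.conj_eq_iff_im.1 hz.2.1
    simp [him]

end HermitianDirichlet

namespace HermitianDirichlet

variable {n : ℕ} {a : Cn n → Matrix (Fin n) (Fin n) ℂ}
  {u : Cn n → ℂ} {p q : Fin n → Cn n → ℂ} {φ ψ : Cn n → ℂ} {R : ℝ}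

/-! ### Weak solutions -/

lemma weakLHS_const_mul (hφ : IsTest φ) (c : ℂ) :
    weakLHS a q (fun z => c * φ z) = c * weakLHS a q φ := by
  rw [weakLHS, weakLHS, ← integral_const_mul]
  congr 1
  ext z
  simp only [del_eq_wirtinger, wirtinger_const_mul hφ.smooth, Finset.mul_sum]
  refine Finset.sum_congr rfl fun i _ => Finset.sum_congr rfl fun j _ => by ring

lemma weakRHS_const_mul (c : ℂ) : weakRHS a R (fun z => c * φ z) = c * weakRHS a R φ := by
  rw [weakRHS, weakRHS, ← integral_const_mul]
  congr 1
  ext z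
  ring

lemma weakLHS_eq (q : Fin n → Cn n → ℂ) (φ : Cn n → ℂ) :
    weakLHS a q φ = ∫ z in D n, ∑ i, ∑ j, coeff a i j z * (del i φ z * q j z) := by
  rw [weakLHS]
  congr 1
  ext z
  simp only [coeff]
  refine Finset.sum_congr rfl fun i _ => Finset.sum_congr rfl fun j _ => by ring

lemma weakLHS_add (hn : 0 < n) (ha : IsUniformlyElliptic a) (hq : ∀ i, MemLp (q i) 2 (volD n))
    (hφ : IsTest φ) (hψ : IsTest ψ) :
    weakLHS a q (fun z => φ z + ψ z) = weakLHS a q φ + weakLHS a q ψ := by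
  rw [weakLHS_eq, weakLHS_eq, weakLHS_eq, ← integral_add
    (ha.integrable_form hn (fun i => (hφ.del i).memLp) hq)
    (ha.integrable_form hn (fun i => (hψ.del i).memLp) hq)]
  congr 1
  ext z
  simp only [del_eq_wirtinger, wirtinger_add hφ.smooth hψ.smooth, ← Finset.sum_add_distrib]
  refine Finset.sum_congr rfl fun i _ => Finset.sum_congr rfl fun j _ => by ring

lemma weakRHS_add (hn : 0 < n) (ha : IsUniformlyElliptic a) (hφ : IsTest φ) (hψ : IsTest ψ) :
    weakRHS a R (fun z => φ z + ψ z) = weakRHS a R φ + weakRHS a R ψ := by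
  have h {φ : Cn n → ℂ} (hφ : IsTest φ) :
      Integrable (fun z => (R : ℂ) * detLower a z * φ z) (volD n) := by
    simpa only [mul_assoc] using (integrable_bounded_mul (ha.memLp_detLower hn)
      (hφ.memLp.integrable (by norm_num))).const_mul (R : ℂ)
  rw [weakRHS, weakRHS, weakRHS, ← integral_add (h hφ) (h hψ)]
  congr 1
  ext z
  ring

/-- Equality of real parts for all complex test functions is the full weak equation. -/
lemma isWeakSolution_of_re (h : ∀ φ, IsTest φ → (weakLHS a q fun z => conj (φ z)).re =
    (weakRHS a R fun z => conj (φ z)).re) : IsWeakSolution a R q := by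
  have h' (φ : Cn n → ℂ) (hφ : IsTest φ) : (weakLHS a q φ).re = (weakRHS a R φ).re := by
    simpa using h _ hφ.conjugate
  refine fun φ hφ => Complex.ext (h' φ hφ) ?_
  -- The real part of `-√-1 w` is the imaginary part of `w`.
  have h2 := h' _ (hφ.const_mul (-Complex.I))
  rw [weakLHS_const_mul hφ, weakRHS_const_mul] at h2
  simpa using h2

lemma isWeakSolution_of_real (hn : 0 < n) (ha : IsUniformlyElliptic a)
    (hq : ∀ i, MemLp (q i) 2 (volD n))
    (h : ∀ φ : Cn n → ℝ, IsTest (fun z => (φ z : ℂ)) →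
      weakLHS a q (fun z => (φ z : ℂ)) = weakRHS a R fun z => (φ z : ℂ)) :
    IsWeakSolution a R q := by
  intro φ hφ
  have hre : IsTest fun z => ((φ z).re : ℂ) := by
    convert (hφ.add hφ.conjugate).const_mul (1 / 2) using 2 with z
    rw [Complex.add_conj]
    push_cast
    ring
  have him : IsTest fun z => ((φ z).im : ℂ) := by
    convert (hφ.add (hφ.conjugate.const_mul (-1))).const_mul (-Complex.I / 2) using 2 with z
    rw [neg_one_mul, ← sub_eq_add_neg, Complex.sub_conj]
    push_cast
    linear_combination ((φ z).im : ℂ) * Complex.I_sq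
  have e : φ = fun z => ((φ z).re : ℂ) + Complex.I * ((φ z).im : ℂ) := by
    ext z
    rw [mul_comm]
    exact (Complex.re_add_im (φ z)).symm
  rw [e, weakLHS_add hn ha hq hre (him.const_mul _), weakRHS_add hn ha hre (him.const_mul _),
    weakLHS_const_mul him, weakRHS_const_mul, h _ hre, h _ him]

/-! ### Divergence-free coefficients -/

/-- The conjugate of the divergence condition. -/
lemma IsDivFree.integral_delbar (hn : 0 < n) (ha : IsUniformlyElliptic a) (hdiv : IsDivFree a)
    (i : Fin n) (hφ : IsTest φ) : ∫ z in D n, ∑ j, coeff a i j z * delbar j φ z = 0 := by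
  obtain ⟨c, M, -, hae⟩ := ha.exists_bounds hn
  have h := congrArg conj (hdiv i _ hφ.conjugate)
  rw [← integral_conj, map_zero] at h
  rw [← h]
  refine integral_congr_ae ?_
  filter_upwards [hae] with z hz
  simp only [map_sum]
  refine Finset.sum_congr rfl fun j _ => ?_
  rw [del_conj hφ.smooth, map_mul, Complex.conj_conj, ← hz.2.2.2.1]
  rfl

lemma memLp_of_continuous {f : Cn n → ℂ} (hf : Continuous f) : MemLp f 2 (volD n) := by
  obtain ⟨C, hC⟩ := (isCompact_closedBall (0 : Cn n) 1).exists_bound_of_continuousOn hf.continuousOn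
  refine MemLp.of_bound hf.aestronglyMeasurable C ?_
  filter_upwards [ae_restrict_mem measurableSet_ball] with z hz
  exact hC z (ball_subset_closedBall hz)

lemma tendsto_integral_mul {f : ℕ → Cn n → ℂ} {g : Cn n → ℂ} (hf : ∀ k, Continuous (f k))
    (hu : MemLp u 2 (volD n)) (hg : MemLp g 2 (volD n))
    (hfu : Tendsto (fun k => eLpNorm (fun z => f k z - u z) 2 (volD n)) atTop (𝓝 0)) :
    Tendsto (fun k => ∫ z in D n, f k z * g z) atTop (𝓝 (∫ z in D n, u z * g z)) := by
  have h1 : Tendsto (fun k => (memLp_of_continuous (hf k)).toLp (f k)) atTop (𝓝 (hu.toLp u)) := by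
    rw [Lp.tendsto_Lp_iff_tendsto_eLpNorm']
    refine hfu.congr fun k => eLpNorm_congr_ae ?_
    exact ((memLp_of_continuous (hf k)).coeFn_toLp.sub hu.coeFn_toLp).symm
  have h2 := ((continuous_integral_mul hg).tendsto _).comp h1
  rw [integral_mul_congr_ae hu.coeFn_toLp] at h2
  refine h2.congr fun k => ?_
  exact integral_mul_congr_ae (memLp_of_continuous (hf k)).coeFn_toLp g

/-- If the coefficients are divergence-free, all derivatives can be moved to the test function.
This holds for smooth functions, and for `u` by approximation. -/
lemma weakLHS_eq_of_isDivFree (hn : 0 < n) (ha : IsUniformlyElliptic a) (hdiv : IsDivFree a)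
    {h : bdD n → ℂ} (hu : Admissible h u p q) (hφ : IsTest φ) :
    weakLHS a q φ =
      -∫ z in D n, ∑ i, ∑ j, coeff a i j z * (delbar j (del i φ) z * u z) := by
  obtain ⟨huW, -, f, hf, hfu, -, hfq, -⟩ := hu
  have hg1 (i j : Fin n) : MemLp (fun z => coeff a i j z * del i φ z) 2 (volD n) :=
    (hφ.del i).memLp.mul (ha.memLp_coeff hn i j)
  have hg2 (i j : Fin n) : MemLp (fun z => coeff a i j z * delbar j (del i φ) z) 2 (volD n) :=
    ((hφ.del i).delbar j).memLp.mul (ha.memLp_coeff hn i j)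
  set G : (Cn n → ℂ) → (Fin n → Cn n → ℂ) → ℂ := fun u q =>
    ∑ i, ∑ j, ((∫ z in D n, q j z * (coeff a i j z * del i φ z)) +
      ∫ z in D n, u z * (coeff a i j z * delbar j (del i φ) z)) with hG
  have hGeq {v : Cn n → ℂ} {r : Fin n → Cn n → ℂ} (hv : MemLp v 2 (volD n))
      (hr : ∀ j, MemLp (r j) 2 (volD n)) : G v r = weakLHS a r φ +
        ∫ z in D n, ∑ i, ∑ j, coeff a i j z * (delbar j (del i φ) z * v z) := by
    have hI : Integrable
        (fun z => ∑ i, ∑ j, coeff a i j z * (delbar j (del i φ) z * v z)) (volD n) :=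
      integrable_finsetSum _ fun i _ => integrable_finsetSum _ fun j _ => integrable_bounded_mul
        (ha.memLp_coeff hn i j) (((hφ.del i).delbar j).memLp.integrable_mul hv)
    rw [weakLHS_eq, ← integral_add (ha.integrable_form hn (fun i => (hφ.del i).memLp) hr) hI]
    have hi1 (i j : Fin n) : Integrable (fun z => r j z * (coeff a i j z * del i φ z)) (volD n) :=
      (hr j).integrable_mul (hg1 i j)
    have hi2 (i j : Fin n) :
        Integrable (fun z => v z * (coeff a i j z * delbar j (del i φ) z)) (volD n) :=
      hv.integrable_mul (hg2 i j)
    have hi12 (i j : Fin n) : Integrable (fun z => r j z * (coeff a i j z * del i φ z) +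
        v z * (coeff a i j z * delbar j (del i φ) z)) (volD n) := (hi1 i j).add (hi2 i j)
    simp only [hG, ← integral_add (hi1 _ _) (hi2 _ _)]
    simp only [← integral_finsetSum _ fun j _ => hi12 _ j]
    rw [← integral_finsetSum _ fun i _ => integrable_finsetSum _ fun j _ => hi12 i j]
    congr 1
    ext z
    simp only [← Finset.sum_add_distrib]
    refine Finset.sum_congr rfl fun i _ => Finset.sum_congr rfl fun j _ => by ring
  have hG0 (k : ℕ) : G (f k) (fun j => delbar j (f k)) = 0 := by
    simp only [hG]
    refine Finset.sum_eq_zero fun i _ => ?_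
    rw [← hdiv.integral_delbar hn ha i ((hφ.del i).mul_left (hf k))]
    have hi1 (j : Fin n) :
        Integrable (fun z => delbar j (f k) z * (coeff a i j z * del i φ z)) (volD n) :=
      (memLp_of_continuous (contDiff_delbar (hf k) j).continuous).integrable_mul (hg1 i j)
    have hi2 (j : Fin n) :
        Integrable (fun z => f k z * (coeff a i j z * delbar j (del i φ) z)) (volD n) :=
      (memLp_of_continuous (hf k).continuous).integrable_mul (hg2 i j)
    have hi12 (j : Fin n) : Integrable (fun z => delbar j (f k) z * (coeff a i j z * del i φ z) +
        f k z * (coeff a i j z * delbar j (del i φ) z)) (volD n) := (hi1 j).add (hi2 j)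
    simp only [← integral_add (hi1 _) (hi2 _)]
    rw [← integral_finsetSum _ fun j _ => hi12 j]
    congr 1
    ext z
    refine Finset.sum_congr rfl fun j _ => ?_
    simp only [delbar_eq_wirtinger, wirtinger_mul (hf k) (hφ.del i).smooth]
    ring
  have hlim : Tendsto (fun k => G (f k) fun j => delbar j (f k)) atTop (𝓝 (G u q)) := by
    simp only [hG]
    refine tendsto_finsetSum _ fun i _ => tendsto_finsetSum _ fun j _ => Tendsto.add ?_ ?_
    · exact tendsto_integral_mul (fun k => (contDiff_delbar (hf k) j).continuous)
        (huW.memLp_delbar j) (hg1 i j) (hfq j)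
    · exact tendsto_integral_mul (fun k => (hf k).continuous) huW.memLp (hg2 i j) hfu
  simp only [hG0] at hlim
  have := tendsto_nhds_unique hlim tendsto_const_nhds
  rw [hGeq huW.memLp huW.memLp_delbar] at this
  exact eq_neg_of_add_eq_zero_left this

/-- For divergence-free coefficients, the left-hand side of the equation is real for real `u`. -/
lemma conj_weakLHS_of_isDivFree (hn : 0 < n) (ha : IsUniformlyElliptic a) (hdiv : IsDivFree a)
    {h : bdD n → ℂ} {u : Cn n → ℝ} (hu : Admissible h (fun z => (u z : ℂ)) p q) {φ : Cn n → ℝ}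
    (hφ : IsTest fun z => (φ z : ℂ)) :
    conj (weakLHS a q fun z => (φ z : ℂ)) = weakLHS a q fun z => (φ z : ℂ) := by
  obtain ⟨c, M, -, hae⟩ := ha.exists_bounds hn
  have hreal : (fun z => conj (φ z : ℂ)) = fun z => (φ z : ℂ) := by
    ext z
    exact Complex.conj_ofReal _
  have hd (i j : Fin n) (z : Cn n) : conj (delbar j (del i fun z => (φ z : ℂ)) z) =
      delbar i (del j fun z => (φ z : ℂ)) z := by
    rw [← del_conj (hφ.del i).smooth]
    simp only [← delbar_conj hφ.smooth]
    rw [hreal]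
    simp only [del_eq_wirtinger, delbar_eq_wirtinger]
    exact congrFun (wirtinger_comm hφ.smooth _ _ _ _) z
  rw [weakLHS_eq_of_isDivFree hn ha hdiv hu hφ, map_neg, ← integral_conj]
  congr 1
  refine integral_congr_ae ?_
  filter_upwards [hae] with z hz
  simp only [map_sum, map_mul, hz.2.2.2.1, hd, Complex.conj_ofReal]
  exact Finset.sum_comm

lemma conj_weakRHS (hn : 0 < n) (ha : IsUniformlyElliptic a) (R : ℝ) (φ : Cn n → ℝ) :
    conj (weakRHS a R fun z => (φ z : ℂ)) = weakRHS a R fun z => (φ z : ℂ) := by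
  obtain ⟨c, M, -, hae⟩ := ha.exists_bounds hn
  rw [weakRHS, ← integral_conj]
  refine integral_congr_ae ?_
  filter_upwards [hae] with z hz
  simp only [map_mul, hz.2.1, Complex.conj_ofReal]

end HermitianDirichlet

namespace HermitianDirichlet

variable {n : ℕ} {a : Cn n → Matrix (Fin n) (Fin n) ℂ} {R : ℝ} {X Y : Jet n}

/-! ### Minimizers -/

/-- Triples `(u, p, q)` with real-valued `u`. -/
def realJets (n : ℕ) : Submodule ℝ (Jet n) :=
  (Complex.imCLM.compLpL 2 (volD n) ∘L
    (PiLp.proj 2 _ none : Jet n →L[ℝ] Lp ℂ 2 (volD n))).toLinearMap.ker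

lemma isClosed_realJets (n : ℕ) : IsClosed (realJets n : Set (Jet n)) :=
  ContinuousLinearMap.isClosed_ker _

lemma mem_realJets_iff : X ∈ realJets n ↔ ∀ᵐ z ∂(volD n), (X none z).im = 0 := by
  have h1 : X ∈ realJets n ↔ Complex.imCLM.compLp (X none) = 0 := Iff.rfl
  rw [h1, Lp.eq_zero_iff_ae_eq_zero]
  have h2 := Complex.imCLM.coeFn_compLp (X none)
  constructor <;> intro h <;> filter_upwards [h, h2] with z hz hz2
  · rw [← Complex.imCLM_apply, ← hz2, hz]; rfl
  · rw [hz2, Complex.imCLM_apply, hz]; rfl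

lemma mem_realJets {u : Cn n → ℝ} {p q : Fin n → Cn n → ℂ}
    (hX : Represents X (fun z => (u z : ℂ)) p q) : X ∈ realJets n :=
  mem_realJets_iff.2 (hX.fst.mono fun z hz => by rw [hz, Complex.ofReal_im])

lemma represents_of_mem_realJets (hX : X ∈ realJets n) :
    Represents X (fun z => ((X none z).re : ℂ)) (fun i => X (some (.inl i)))
      fun i => X (some (.inr i)) :=
  ⟨(mem_realJets_iff.1 hX).mono fun z hz => by apply Complex.ext <;> simp [hz],
    fun _ => .rfl, fun _ => .rfl⟩

theorem exists_isMinimizer (hn : 0 < n) (ha : IsUniformlyElliptic a) (R : ℝ) {h : bdD n → ℂ}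
    {w : Cn n → ℂ} {p q : Fin n → Cn n → ℂ} (hw : Admissible h w p q) :
    ∃ u p q, IsMinimizer a R h u p q := by
  obtain ⟨B, ℓ, c, hc, hsymm, hco, hE, -⟩ := exists_energy_forms hn ha R
  obtain ⟨W, hW⟩ := hw.1.exists_represents
  obtain ⟨X, hXW, hmin⟩ := exists_forall_le_of_coercive hsymm ℓ (isClosed_zeroJets n) hc hco W
  refine ⟨_, _, _, hw.add_mem_zeroJets hW hXW (represents_self X), fun v p₁ q₁ hv => ?_⟩
  obtain ⟨Y, hY⟩ := hv.1.exists_represents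
  rw [hE (represents_self X), hE hY]
  exact hmin Y (hv.sub_mem_zeroJets hn hw hY hW)

theorem exists_isRealMinimizer (hn : 0 < n) (ha : IsUniformlyElliptic a) (R : ℝ) {h : bdD n → ℝ}
    {w : Cn n → ℂ} {p q : Fin n → Cn n → ℂ} (hw : Admissible (fun x => (h x : ℂ)) w p q) :
    ∃ u p q, IsRealMinimizer a R h u p q := by
  obtain ⟨B, ℓ, c, hc, hsymm, hco, hE, -⟩ := exists_energy_forms hn ha R
  obtain ⟨p', q', hw'⟩ := hw.exists_real
  obtain ⟨W, hW⟩ := hw'.1.exists_represents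
  have hWR := mem_realJets hW
  obtain ⟨X, ⟨hXW, hXR⟩, hmin⟩ := exists_forall_le_of_coercive hsymm ℓ
    (V := zeroJets n ⊓ realJets n) ((isClosed_zeroJets n).inter (isClosed_realJets n)) hc
    (fun X hX => hco X hX.1) W
  have hX : X ∈ realJets n := by simpa using (realJets n).add_mem hXR hWR
  refine ⟨_, _, _, hw'.add_mem_zeroJets hW hXW (represents_of_mem_realJets hX),
    fun v p₁ q₁ hv => ?_⟩
  obtain ⟨Y, hY⟩ := hv.1.exists_represents
  rw [hE (represents_of_mem_realJets hX), hE hY]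
  exact hmin Y ⟨hv.sub_mem_zeroJets hn hw' hY hW, (realJets n).sub_mem (mem_realJets hY) hWR⟩

/-- If no admissible variation in the direction of `φ` decreases the energy, the real part of the
weak equation holds, tested against the conjugate of `φ`. -/
lemma re_weakLHS_eq_of_forall_le (hn : 0 < n) (ha : IsUniformlyElliptic a) {h : bdD n → ℂ}
    {u φ : Cn n → ℂ} {p q : Fin n → Cn n → ℂ} (hu : Admissible h u p q) (hφ : IsTest φ)
    (hmin : ∀ (t : ℝ) (p₁ q₁ : Fin n → Cn n → ℂ), Admissible h (fun z => u z + t * φ z) p₁ q₁ →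
      energy a R u q ≤ energy a R (fun z => u z + t * φ z) q₁) :
    (weakLHS a q fun z => conj (φ z)).re = (weakRHS a R fun z => conj (φ z)).re := by
  obtain ⟨B, ℓ, c, hc, hsymm, -, hE, hEL⟩ := exists_energy_forms hn ha R
  obtain ⟨X, hX⟩ := hu.1.exists_represents
  obtain ⟨Φ, hΦ⟩ := hφ.exists_represents
  obtain ⟨h1, h2⟩ := hEL hX hφ hΦ
  rw [← h1, ← h2]
  refine apply_eq_of_forall_le hsymm ℓ fun t => ?_
  have hXt := hX.linearComb hΦ 1 t
  simp only [one_smul, Complex.ofReal_one, one_mul] at hXt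
  rw [← hE hX, ← hE hXt]
  refine hmin t _ _ (hu.add_mem_zeroJets hX ?_ hXt)
  rw [add_sub_cancel_left]
  exact (zeroJets n).smul_mem t (mem_zeroJets_of_isTest hφ hΦ)

theorem IsMinimizer.isWeakSolution (hn : 0 < n) (ha : IsUniformlyElliptic a) {h : bdD n → ℂ}
    {u : Cn n → ℂ} {p q : Fin n → Cn n → ℂ} (hu : IsMinimizer a R h u p q) :
    IsWeakSolution a R q :=
  isWeakSolution_of_re fun _ hφ =>
    re_weakLHS_eq_of_forall_le hn ha hu.1 hφ fun _ p₁ q₁ hv => hu.2 _ p₁ q₁ hv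

theorem IsRealMinimizer.isWeakSolutionRe (hn : 0 < n) (ha : IsUniformlyElliptic a)
    {h : bdD n → ℝ} {u : Cn n → ℝ} {p q : Fin n → Cn n → ℂ} (hu : IsRealMinimizer a R h u p q) :
    IsWeakSolutionRe a R q := by
  intro φ hφ
  have h1 := re_weakLHS_eq_of_forall_le (R := R) hn ha hu.1 hφ fun t p₁ q₁ hv => by
    have e : (fun z => (u z : ℂ) + t * (φ z : ℂ)) = fun z => ((u z + t * φ z : ℝ) : ℂ) := by
      ext z
      push_cast
      rfl
    rw [e] at hv ⊢
    exact hu.2 _ p₁ q₁ hv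
  simpa only [Complex.conj_ofReal] using h1

theorem IsRealMinimizer.isWeakSolution (hn : 0 < n) (ha : IsUniformlyElliptic a)
    (hdiv : IsDivFree a) {h : bdD n → ℝ} {u : Cn n → ℝ} {p q : Fin n → Cn n → ℂ}
    (hu : IsRealMinimizer a R h u p q) : IsWeakSolution a R q := by
  refine isWeakSolution_of_real hn ha hu.1.1.memLp_delbar fun φ hφ =>
    Complex.ext (hu.isWeakSolutionRe hn ha φ hφ) ?_
  rw [Complex.conj_eq_iff_im.1 (conj_weakLHS_of_isDivFree hn ha hdiv hu.1 hφ),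
    Complex.conj_eq_iff_im.1 (conj_weakRHS hn ha R φ)]

end HermitianDirichlet

end

theorem theorem6p3 (n : ℕ) (hn : 0 < n)
    (a : HermitianDirichlet.Cn n → Matrix (Fin n) (Fin n) ℂ)
    (ha : HermitianDirichlet.IsUniformlyElliptic a) (R : ℝ) :
    (∀ h : HermitianDirichlet.bdD n → ℂ,
      (∃ w p q, HermitianDirichlet.Admissible h w p q) →
        (∃ u p q, HermitianDirichlet.IsMinimizer a R h u p q ∧
          HermitianDirichlet.IsWeakSolution a R q) ∧
        (∀ u p q, HermitianDirichlet.IsMinimizer a R h u p q →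
          HermitianDirichlet.IsWeakSolution a R q)) ∧
    (∀ h : HermitianDirichlet.bdD n → ℝ,
      (∃ w p q, HermitianDirichlet.Admissible (fun x => (h x : ℂ)) w p q) →
        (∃ u p q, HermitianDirichlet.IsRealMinimizer a R h u p q) ∧
        (∀ u p q, HermitianDirichlet.IsRealMinimizer a R h u p q →
          HermitianDirichlet.IsWeakSolutionRe a R q ∧
          (HermitianDirichlet.IsDivFree a → HermitianDirichlet.IsWeakSolution a R q))) := by
  refine ⟨fun h ⟨w, p, q, hw⟩ => ⟨?_, fun u p q hu => hu.isWeakSolution hn ha⟩,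
    fun h ⟨w, p, q, hw⟩ => ⟨HermitianDirichlet.exists_isRealMinimizer hn ha R hw,
      fun u p q hu => ⟨hu.isWeakSolutionRe hn ha, fun hdiv => hu.isWeakSolution hn ha hdiv⟩⟩⟩
  obtain ⟨u, p', q', hu⟩ := HermitianDirichlet.exists_isMinimizer hn ha R hw
  exact ⟨u, p', q', hu, hu.isWeakSolution hn ha⟩
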